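/- **Setup.** Let $\mathbb F$ be a finite field with $|\mathbb F|=q$, let $\Omega$ be a nonempty finite set, let $\mathbf P=(\Omega,\preccurlyeq)$ be a poset, let $\omega:\Omega\to\mathbb R$ be a map with $\omega(i)>0$ for all $i$, let $(k_i)_{i\in\Omega}$ be positive integers, and put $\mathbf H=\prod_{i\in\Omega}\mathbb F^{k_i}$. Let $\overline{\mathbf P}$ be the dual poset, let $\operatorname{len}(y)$ be the largest cardinality of a chain in $\mathbf P$ with greatest element $y$, let $m$ be the largest cardinality of a chain in $\mathbf P$, and put $W_r=\{u\in\Omega:\operatorname{len}(u)=r\}$. The poset $\mathbf P$ is *hierarchical* if $\operatorname{len}(u)<\operatorname{len}(v)$ implies $u\preccurlyeq v$. An *ideal* of $\mathbf P$ is a down-closed subset of $\Omega$, and $\langle B\rangle_{\mathbf P}$ is the ideal generated by $B\subseteq\Omega$. For $\beta\in\mathbf H$ let $\operatorname{supp}(\beta)=\{i:\beta_i\ne0\}$ and $\operatorname{wt}_{(\mathbf P,\omega)}(\beta)=\sum_{i\in\langle\operatorname{supp}(\beta)\rangle_{\mathbf P}}\omega(i)$. A *$(\mathbf P,\omega)$-isometry*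 is an $\mathbb F$-linear automorphism of $\mathbf H$ that preserves $\operatorname{wt}_{(\mathbf P,\omega)}$. Let $\mathcal Q(\mathbf P,\omega)$ be the partition of $\mathbf H$ into the sets of vectors of equal $(\mathbf P,\omega)$-weight, and define $\mathcal Q(\overline{\mathbf P},\omega)$ likewise. Let $\langle\alpha,\beta\rangle=\sum_{i}\sum_{t=1}^{k_i}\alpha_{i,t}\beta_{i,t}$, and for a subspace $C\subseteq\mathbf H$ let $C^\perp=\{\beta\in\mathbf H:\langle\alpha,\beta\rangle=0\text{ for all }\alpha\in C\}$. Fix a nontrivial additive character $\chi:\mathbb F\to\mathbb C^\times$. For a partition $\Gamma$ of $\mathbf H$, let $l(\Gamma)$ be the partition in which $\alpha,\gamma$ are equivalent if and only if $\sum_{\beta\in B}\chi(\langle\alpha,\beta\rangle)=\sum_{\beta\in B}\chi(\langle\gamma,\beta\rangle)$ for all $B\in\Gamma$. **Theorem 6.5.** Consider the following statements. 1. (MacWilliams extension property) For every subspace $C\subseteq\mathbf H$, every $\mathbb F$-linear map $C\to\mathbf H$ that preserves $\operatorname{wt}_{(\mathbf P,\omega)}$ is the restriction to $C$ of a $(\mathbf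 P,\omega)$-isometry of $\mathbf H$. 2. For all $\gamma,\theta\in\mathbf H$ with $\operatorname{wt}_{(\mathbf P,\omega)}(\gamma)=\operatorname{wt}_{(\mathbf P,\omega)}(\theta)$ there is a $(\mathbf P,\omega)$-isometry $\psi$ of $\mathbf H$ with $\psi(\gamma)=\theta$. 3. (Condition (D)) For all ideals $I,J$ of $\mathbf P$ with $\sum_{i\in I}\omega(i)=\sum_{j\in J}\omega(j)$ there is an order automorphism $\lambda$ of $\mathbf P$ with $J=\lambda[I]$ and $\omega\circ\lambda=\omega$; and for all $u,v\in\Omega$ with $\operatorname{len}(u)=\operatorname{len}(v)$ and $\omega(u)=\omega(v)$ one has $\mathbb F^{k_u}\cong\mathbb F^{k_v}$ as $\mathbb F$-vector spaces. 4. $\mathcal Q(\overline{\mathbf P},\omega)=l(\mathcal Q(\mathbf P,\omega))$. 5. (MacWilliams identity) For any two subspaces $C_1,C_2\subseteq\mathbf H$: if $|C_1\cap B|=|C_2\cap B|$ for all $B\in\mathcal Q(\overline{\mathbf P},\omega)$, then $|C_1^\perp\cap B|=|C_2^\perp\cap B|$ for all $B\in\mathcal Q(\mathbf P,\omega)$.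 6. (Fourier-reflexivity) $l(l(\mathcal Q(\mathbf P,\omega)))=\mathcal Q(\mathbf P,\omega)$. 7. For every $r\in\{1,\dots,m\}$ and every $b\in\omega[W_r]$, either $k_i=1$ for all $i\in W_r$ with $\omega(i)=b$, or $|\{i\in W_r:\omega(i)=b\}|\le q$. Then $(1)\Rightarrow(2)$, $(2)\Leftrightarrow(3)$, $(3)\Rightarrow(4)$, $(4)\Leftrightarrow(5)$ and $(5)\Rightarrow(6)$. If $\mathbf P$ is hierarchical, then $(1)\Leftrightarrow\big((3)\wedge(7)\big)$. If $\mathbf P$ is hierarchical and $\omega$ is integer-valued, then (2)–(6) are all equivalent to each other. -/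

import Mathlib

namespace WeightedPoset

universe u v w

/-- The ideal of `P` generated by `B`. -/
def idealGen {Ω : Type u} (P : PartialOrder Ω) (B : Set Ω) : Set Ω :=
  {a | ∃ b ∈ B, P.le a b}

/-- `I` is an ideal (down-closed subset) of `P`. -/
def IsIdeal {Ω : Type u} (P : PartialOrder Ω) (I : Set Ω) : Prop :=
  ∀ b ∈ I, ∀ a, P.le a b → a ∈ I

/-- The dual poset, on the same ground set. -/
abbrev dualPoset {Ω : Type u} (P : PartialOrder Ω) : PartialOrder Ω where
  le x y := P.le y x
  lt x y := P.lt y x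
  lt_iff_le_not_ge x y := P.lt_iff_le_not_ge y x
  le_refl x := P.le_refl x
  le_trans x y z hxy hyz := P.le_trans z y x hyz hxy
  le_antisymm x y hxy hyx := P.le_antisymm x y hyx hxy

open Classical in
/-- The largest cardinality of a chain in `P` containing `y` as its greatest element. -/
noncomputable def len {Ω : Type u} [Fintype Ω] (P : PartialOrder Ω) (y : Ω) : ℕ :=
  (Finset.univ.filter (fun B : Finset Ω =>
    IsChain P.le (B : Set Ω) ∧ y ∈ B ∧ ∀ b ∈ B, P.le b y)).sup Finset.card

open Classical in
/-- The largest cardinality of a chain in `P`. -/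
noncomputable def maxChainCard {Ω : Type u} [Fintype Ω] (P : PartialOrder Ω) : ℕ :=
  (Finset.univ.filter (fun B : Finset Ω => IsChain P.le (B : Set Ω))).sup Finset.card

/-- The `r`-th level of `P`. -/
def level {Ω : Type u} [Fintype Ω] (P : PartialOrder Ω) (r : ℕ) : Set Ω :=
  {i | len P i = r}

def IsHierarchical {Ω : Type u} [Fintype Ω] (P : PartialOrder Ω) : Prop :=
  ∀ u v : Ω, len P u + 1 ≤ len P v → P.le u v

/-- The unique decomposition property. An order automorphism of `P` is a relation isomorphism
of `P.le` with itself. -/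
def UDP {Ω : Type u} (P : PartialOrder Ω) (ω : Ω → ℝ) : Prop :=
  ∀ I J : Finset Ω, IsIdeal P (I : Set Ω) → IsIdeal P (J : Set Ω) →
    ∑ i ∈ I, ω i = ∑ j ∈ J, ω j →
    ∃ l : P.le ≃r P.le, (J : Set Ω) = l '' (I : Set Ω) ∧ ∀ i, ω (l i) = ω i

section Modules

/-- The set of coordinates at which `β` does not vanish. -/
def supp {Ω : Type u} {H : Ω → Type v} [∀ i, AddCommGroup (H i)] (β : ∀ i, H i) : Set Ω :=
  {i | β i ≠ 0}

open Classical in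
/-- The `(P, ω)`-weight. -/
noncomputable def wt {Ω : Type u} [Fintype Ω] {H : Ω → Type v} [∀ i, AddCommGroup (H i)]
    (P : PartialOrder Ω) (ω : Ω → ℝ) (β : ∀ i, H i) : ℝ :=
  ∑ i ∈ Finset.univ.filter (fun i => i ∈ idealGen P (supp β)), ω i

/-- The `S`-module automorphism `φ` is a `(P, ω)`-weight isometry. -/
def IsWeightIsometry (S : Type w) [Ring S] {Ω : Type u} [Fintype Ω] {H : Ω → Type v}
    [∀ i, AddCommGroup (H i)] [∀ i, Module S (H i)]
    (P : PartialOrder Ω) (ω : Ω → ℝ) (φ : (∀ i, H i) ≃ₗ[S] (∀ i, H i)) : Prop :=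
  ∀ α, wt P ω (φ α) = wt P ω α

/-- The MacWilliams extension property for `(P, ω)`-weight. -/
def MEP (S : Type w) [Ring S] {Ω : Type u} [Fintype Ω] (H : Ω → Type v)
    [∀ i, AddCommGroup (H i)] [∀ i, Module S (H i)]
    (P : PartialOrder Ω) (ω : Ω → ℝ) : Prop :=
  ∀ (C : Submodule S (∀ i, H i)) (f : C →ₗ[S] (∀ i, H i)),
    (∀ α : C, wt P ω (f α) = wt P ω (α : ∀ i, H i)) →
    ∃ φ : (∀ i, H i) ≃ₗ[S] (∀ i, H i), IsWeightIsometry S P ω φ ∧ ∀ α : C, φ α = f α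

/-- The weight isometries act transitively on vectors of equal weight. -/
def IsometriesTransitive (S : Type w) [Ring S] {Ω : Type u} [Fintype Ω] (H : Ω → Type v)
    [∀ i, AddCommGroup (H i)] [∀ i, Module S (H i)]
    (P : PartialOrder Ω) (ω : Ω → ℝ) : Prop :=
  ∀ γ θ : (∀ i, H i), wt P ω γ = wt P ω θ →
    ∃ ψ : (∀ i, H i) ≃ₗ[S] (∀ i, H i), IsWeightIsometry S P ω ψ ∧ ψ γ = θ

/-- The UDP holds, and blocks of equal length and equal weight are isomorphic. -/
def ConditionD (S : Type w) [Ring S] {Ω : Type u} [Fintype Ω] (H : Ω → Type v)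
    [∀ i, AddCommGroup (H i)] [∀ i, Module S (H i)]
    (P : PartialOrder Ω) (ω : Ω → ℝ) : Prop :=
  UDP P ω ∧ ∀ u v : Ω, len P u = len P v → ω u = ω v → Nonempty (H u ≃ₗ[S] H v)

/-- The partition of the ambient space by `(P, ω)`-weight (as an equivalence relation, whose
classes are the members of the partition). -/
noncomputable def weightPartition {Ω : Type u} [Fintype Ω] (H : Ω → Type v) [∀ i, AddCommGroup (H i)]
    (P : PartialOrder Ω) (ω : Ω → ℝ) : Setoid (∀ i, H i) :=
  Setoid.ker (wt P ω)

end Modules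

section FiniteField

/-- The ambient space `∏ i, F ^ (k i)`. -/
abbrev Amb {Ω : Type u} (F : Type v) (k : Ω → ℕ) : Type (max u v) :=
  ∀ i : Ω, Fin (k i) → F

/-- The standard inner product. -/
def ip {Ω : Type u} [Fintype Ω] {F : Type v} [Field F] {k : Ω → ℕ} (α β : Amb F k) : F :=
  ∑ i, ∑ t, α i t * β i t

/-- The dual code. -/
def dualCode {Ω : Type u} [Fintype Ω] {F : Type v} [Field F] {k : Ω → ℕ}
    (C : Submodule F (Amb F k)) : Set (Amb F k) :=
  {β | ∀ α ∈ C, ip α β = 0}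

/-- `D₁` and `D₂` have the same `Γ`-distribution. -/
def SameDistribution {X : Type u} (Γ : Setoid X) (D₁ D₂ : Set X) : Prop :=
  ∀ B ∈ Γ.classes, (D₁ ∩ B).ncard = (D₂ ∩ B).ncard

/-- `(P, ω)` admits MacWilliams identity. -/
def AdmitsMacWilliamsIdentity {Ω : Type u} [Fintype Ω] (F : Type v) [Field F]
    (k : Ω → ℕ) (P : PartialOrder Ω) (ω : Ω → ℝ) : Prop :=
  ∀ C₁ C₂ : Submodule F (Amb F k),
    SameDistribution (weightPartition (fun i => Fin (k i) → F) (dualPoset P) ω)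
      (C₁ : Set (Amb F k)) (C₂ : Set (Amb F k)) →
    SameDistribution (weightPartition (fun i => Fin (k i) → F) P ω)
      (dualCode C₁) (dualCode C₂)

open Classical in
/-- `∑_{β ∈ B} χ(⟨α, β⟩)`. -/
noncomputable def charSum {Ω : Type u} [Fintype Ω] {F : Type v} [Field F] [Fintype F]
    {k : Ω → ℕ} (χ : AddChar F ℂ) (B : Set (Amb F k)) (α : Amb F k) : ℂ :=
  ∑ β ∈ Finset.univ.filter (fun β : Amb F k => β ∈ B), χ (ip α β)

/-- The dual partition `l(Γ)` with respect to the character `χ`. -/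
def dualPartition {Ω : Type u} [Fintype Ω] {F : Type v} [Field F] [Fintype F]
    {k : Ω → ℕ} (χ : AddChar F ℂ) (Γ : Setoid (Amb F k)) : Setoid (Amb F k) where
  r α γ := ∀ B ∈ Γ.classes, charSum χ B α = charSum χ B γ
  iseqv :=
    { refl := fun _ _ _ => rfl
      symm := fun h B hB => (h B hB).symm
      trans := fun h₁ h₂ B hB => (h₁ B hB).trans (h₂ B hB) }

def FourierReflexive {Ω : Type u} [Fintype Ω] {F : Type v} [Field F] [Fintype F]
    {k : Ω → ℕ} (χ : AddChar F ℂ) (Γ : Setoid (Amb F k)) : Prop :=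
  dualPartition χ (dualPartition χ Γ) = Γ

/-- In every level and for every value `b` of `ω` on it, either all the blocks of weight `b` in
that level have dimension one, or there are at most `|F|` of them. -/
def NumericCondition {Ω : Type u} [Fintype Ω] (F : Type v) [Fintype F]
    (k : Ω → ℕ) (P : PartialOrder Ω) (ω : Ω → ℝ) : Prop :=
  ∀ r : ℕ, 1 ≤ r → r ≤ maxChainCard P → ∀ b ∈ ω '' level P r,
    (∀ i ∈ level P r, ω i = b → k i = 1) ∨
      {i | i ∈ level P r ∧ ω i = b}.ncard ≤ Fintype.card F

end FiniteField

end WeightedPoset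

/-! Positivity of `ω` means that nested ideals of equal weight coincide, so the weight is rigid
enough to recover the order. Vectors whose support has a greatest element are exactly those outside
the span of all vectors of smaller weight, and comparing the weights of two such vectors and of
their sum decides the order of their tops. Hence an isometry induces an automorphism of `P` that
preserves `ω` and carries the ideal of each vector to the ideal of its image
(`IsWeightIsometry.exists_relIso`). Sums over principal ideals then show that block dimensions are
preserved too. Conversely, an automorphism together with block isomorphisms and arbitrary
corrections from strictly larger coordinates gives an isometry, and these triangular maps suffice to
move one vector to another.

The Fourier side rests on counting classes. Complementing ideals shows that the weight partitions of
`P` and of its dual have equally many classes. The Fourier transform is injective, so a dual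
partition never has fewer classes than the original. Any inclusion between the two candidate
partitions therefore becomes an equality as soon as the class counts agree. Inclusion comes from
transitivity on the dual poset and adjoints of dual isometries, or from MacWilliams' identity
applied to one-dimensional codes. The identity itself is Poisson summation. Equality of class counts
makes the Fourier map bijective, which gives reflexivity.

For hierarchical posets with integer weights the reverse inclusion comes from a generating function.
If `α` vanishes below level `r`, a suitable function of the weight has Fourier transform at `α`
equal to a nonzero constant times a product over level `r`, with factor `1 - z ^ n` where `α` is
nonzero and `1 + (q ^ k - 1) * z ^ n` where it is zero. Complex roots show that these products
determine the multiset of pairs `(n, k)` on the support (`label_card_eq_of_prod_eq`).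

For extension in a hierarchical poset, a weight-preserving map on a code is recorded by the kernels
of its coordinates on words that vanish above the level. Condition (D) equates the sums of indicator
functions of two families of such kernels. The numeric condition forces these families to agree up
to order, because a space is not a union of at most `q` proper subspaces, while in the
one-dimensional case hyperplanes can be counted. When the numeric condition fails, the `q + 1` lines
of `F × F` have the same indicator sum as `q` zero spaces and one whole plane, which yields a map
with no extension. -/

namespace WeightedPoset

universe u v w

/-! ### Lengths and automorphisms of finite posets -/

section Order

variable {Ω : Type u} [Fintype Ω] (P : PartialOrder Ω)

theorem card_le_len {y : Ω} {B : Finset Ω} (h : IsChain P.le (B : Set Ω)) (hy : y ∈ B)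
    (hB : ∀ b ∈ B, P.le b y) : B.card ≤ len P y := by
  classical
  unfold len
  exact Finset.le_sup (f := Finset.card) (by simp only [Finset.mem_filter_univ]; exact ⟨h, hy, hB⟩)

theorem exists_chain_card_eq_len (y : Ω) : ∃ B : Finset Ω, IsChain P.le (B : Set Ω) ∧ y ∈ B ∧
    (∀ b ∈ B, P.le b y) ∧ B.card = len P y := by
  classical
  obtain ⟨B, hB, hc⟩ := Finset.exists_mem_eq_sup (Finset.univ.filter (fun B : Finset Ω =>
    IsChain P.le (B : Set Ω) ∧ y ∈ B ∧ ∀ b ∈ B, P.le b y))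
    ⟨{y}, by simp⟩ Finset.card
  simp only [Finset.mem_filter_univ] at hB
  exact ⟨B, hB.1, hB.2.1, hB.2.2, by unfold len; convert hc.symm⟩

theorem one_le_len (y : Ω) : 1 ≤ len P y := by
  have := card_le_len P (y := y) (B := {y}) (by simp) (by simp) (by simp)
  simpa using this

theorem len_le_maxChainCard (y : Ω) : len P y ≤ maxChainCard P := by
  classical
  obtain ⟨B, hB, -, -, h⟩ := exists_chain_card_eq_len P y
  rw [← h]
  unfold maxChainCard
  exact Finset.le_sup (f := Finset.card) (by simpa only [Finset.mem_filter_univ] using hB)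

theorem len_lt_len {x y : Ω} (hxy : P.le x y) (hne : x ≠ y) : len P x < len P y := by
  classical
  obtain ⟨B, hB, hx, hle, h⟩ := exists_chain_card_eq_len P x
  have hy : y ∉ B := fun hy => hne (P.le_antisymm _ _ hxy (hle y hy))
  have := card_le_len P (y := y) (B := insert y B) (by
    rw [Finset.coe_insert]
    exact hB.insert fun b hb _ => Or.inr (P.le_trans _ _ _ (hle b hb) hxy)) (by simp) (by
    intro b hb
    rcases Finset.mem_insert.1 hb with rfl | hb
    · exact P.le_refl _
    · exact P.le_trans _ _ _ (hle b hb) hxy)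
  rw [Finset.card_insert_of_notMem hy] at this
  omega

theorem len_le_len {x y : Ω} (hxy : P.le x y) : len P x ≤ len P y := by
  rcases eq_or_ne x y with rfl | hne
  · exact le_rfl
  · exact (len_lt_len P hxy hne).le

theorem len_le_len_apply (l : P.le ≃r P.le) (y : Ω) : len P y ≤ len P (l y) := by
  classical
  obtain ⟨B, hB, hy, hle, h⟩ := exists_chain_card_eq_len P y
  rw [← h, ← Finset.card_map l.toEquiv.toEmbedding]
  refine card_le_len P ?_ (by simpa using hy) ?_
  · rw [Finset.coe_map]
    rintro _ ⟨a, ha, rfl⟩ _ ⟨b, hb, rfl⟩ hab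
    have hne : a ≠ b := fun h => hab (by rw [h])
    exact (hB ha hb hne).imp (fun h => l.map_rel_iff.2 h) (fun h => l.map_rel_iff.2 h)
  · intro b hb
    obtain ⟨a, ha, rfl⟩ := Finset.mem_map.1 hb
    exact l.map_rel_iff.2 (hle a ha)

theorem len_apply (l : P.le ≃r P.le) (y : Ω) : len P (l y) = len P y :=
  le_antisymm (by simpa using len_le_len_apply P l.symm (l y)) (len_le_len_apply P l y)

variable {P} in
theorem IsHierarchical.le_iff (h : IsHierarchical P) {u v : Ω} :
    P.le u v ↔ u = v ∨ len P u < len P v := by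
  constructor
  · intro huv
    rcases eq_or_ne u v with e | e
    · exact Or.inl e
    · exact Or.inr (len_lt_len P huv e)
  · rintro (rfl | huv)
    · exact P.le_refl _
    · exact h u v huv

/-- In a hierarchical poset a permutation that preserves the length is an order automorphism. -/
def IsHierarchical.relIsoOfLen (h : IsHierarchical P) (σ : Equiv.Perm Ω)
    (hσ : ∀ i, len P (σ i) = len P i) : P.le ≃r P.le where
  toEquiv := σ
  map_rel_iff' := by
    intro a b
    rw [h.le_iff, h.le_iff, hσ, hσ, σ.injective.eq_iff]

theorem exists_maximal_above {p : Ω → Prop} {i : Ω} (hi : p i) :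
    ∃ b, P.le i b ∧ p b ∧ ∀ j, P.le b j → p j → j = b := by
  classical
  obtain ⟨b, hb, hmax⟩ := Finset.exists_max_image (Finset.univ.filter fun b => P.le i b ∧ p b)
    (len P) ⟨i, by simp [hi]⟩
  simp only [Finset.mem_filter_univ] at hb hmax
  refine ⟨b, hb.1, hb.2, fun j hj hpj => ?_⟩
  by_contra hne
  exact absurd (len_lt_len P hj (Ne.symm hne)) (not_lt.2 (hmax j ⟨P.le_trans _ _ _ hb.1 hj, hpj⟩))

/-- A function on a finite poset is determined by its sums over principal ideals; hence an order
automorphism that preserves these sums preserves the function. -/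
theorem apply_eq_of_sum_principal_eq (l : P.le ≃r P.le) (f : Ω → ℝ) [DecidableRel P.le]
    (h : ∀ i, ∑ j ∈ Finset.univ.filter (fun j => P.le j (l i)), f j =
      ∑ j ∈ Finset.univ.filter (fun j => P.le j i), f j) (i : Ω) : f (l i) = f i := by
  classical
  induction hn : len P i using Nat.strong_induction_on generalizing i with
  | _ n ih =>
    have key : ∀ i, ∑ j ∈ Finset.univ.filter (fun j => P.le j i), f j =
        f i + ∑ j ∈ Finset.univ.filter (fun j => P.le j i ∧ j ≠ i), f j := by
      intro i
      rw [← Finset.sum_insert (by simp)]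
      congr 1
      ext j
      simp only [Finset.mem_filter_univ, Finset.mem_insert]
      by_cases e : j = i
      · simp [e]
      · simp [e]
    -- The automorphism matches the elements strictly below `i` with those strictly below `l i`,
    -- where the induction hypothesis already applies; subtracting them isolates the values at the
    -- tops.
    have h2 : ∑ j ∈ Finset.univ.filter (fun j => P.le j (l i) ∧ j ≠ l i), f j =
        ∑ j ∈ Finset.univ.filter (fun j => P.le j i ∧ j ≠ i), f j := by
      symm
      refine Finset.sum_equiv l.toEquiv ?_ ?_
      · intro j
        simp only [Finset.mem_filter_univ, RelIso.coe_fn_toEquiv, l.map_rel_iff, ne_eq,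
          l.injective.eq_iff]
      · intro j hj
        simp only [Finset.mem_filter_univ] at hj
        exact (ih (len P j) (hn ▸ len_lt_len P hj.1 hj.2) j rfl).symm
    have h3 := h i
    rw [key, key, h2] at h3
    linarith

end Order

/-! ### Matching finite families by label multiplicities -/

section Labels

open Classical in
/-- Two labellings with the same multiplicities are related by a permutation. -/
theorem exists_perm_of_fiber_card_eq {Ω : Type u} [Fintype Ω] {L : Type v} (c d : Ω → L)
    (h : ∀ l, (Finset.univ.filter (fun i => c i = l)).card =
      (Finset.univ.filter (fun i => d i = l)).card) :
    ∃ σ : Equiv.Perm Ω, ∀ i, d (σ i) = c i := by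
  have key : ∀ (c : Ω → L) (l : L), Nat.card (c ⁻¹' {l} : Set Ω) =
      (Finset.univ.filter (fun i => c i = l)).card := by
    intro c l
    rw [Nat.card_coe_set_eq, ← Set.ncard_coe_finset]
    congr 1
    ext i
    simp
  have e : ∀ l, Nonempty ((c ⁻¹' {l} : Set Ω) ≃ (d ⁻¹' {l} : Set Ω)) := fun l =>
    Finite.card_eq.1 (by rw [key, key, h])
  exact ⟨Equiv.ofPreimageEquiv fun l => (e l).some, fun i => Equiv.ofPreimageEquiv_map _ i⟩

open Classical in
/-- Two subsets of a finite set whose labels have the same multiplicities are related by a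
label-preserving permutation. -/
theorem exists_perm_of_label_card_eq {Ω : Type u} [Fintype Ω] {L : Type v} (c : Ω → L)
    (A B : Finset Ω)
    (h : ∀ l, (A.filter (fun i => c i = l)).card = (B.filter (fun i => c i = l)).card) :
    ∃ σ : Equiv.Perm Ω, (∀ i, c (σ i) = c i) ∧ ∀ i, σ i ∈ B ↔ i ∈ A := by
  have hA : ∀ (A : Finset Ω) (l : L), (A.filter (fun i => c i = l)).card +
      ((Aᶜ).filter (fun i => c i = l)).card = (Finset.univ.filter (fun i => c i = l)).card := by
    intro A l
    rw [← Finset.card_union_of_disjoint, ← Finset.filter_union, Finset.union_compl]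
    exact Finset.disjoint_filter_filter disjoint_compl_right
  have key : ∀ (A : Finset Ω) (x : L × Prop),
      (Finset.univ.filter (fun i => (c i, i ∈ A) = x)).card =
        if x.2 then (A.filter (fun i => c i = x.1)).card
        else ((Aᶜ).filter (fun i => c i = x.1)).card := by
    rintro A ⟨l, p⟩
    by_cases hp : p <;> simp only [hp, if_true, if_false] <;> congr 1 <;> ext i <;>
      simp [and_comm]
  obtain ⟨σ, hσ⟩ := exists_perm_of_fiber_card_eq (fun i => (c i, i ∈ A)) (fun i => (c i, i ∈ B)) (by
    intro x
    refine Eq.trans (by convert key A x) (Eq.trans ?_ (by convert (key B x).symm))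
    have h1 := hA A x.1
    have h2 := hA B x.1
    have h3 := h x.1
    split_ifs <;> omega)
  exact ⟨σ, fun i => congrArg Prod.fst (hσ i), fun i => (congrArg Prod.snd (hσ i)).to_iff⟩

open Classical in
/-- Cancellation principle: if from every pair of finite sets satisfying `R`, not both empty, one
can remove a pair of equally labelled elements without leaving `R`, then label multiplicities
agree. -/
theorem label_card_eq_of_cancel {ι : Type u} {κ : Type v} {L : Type w} (c : ι → L) (d : κ → L)
    (R : Finset ι → Finset κ → Prop)
    (step : ∀ S T, R S T → (S.Nonempty ∨ T.Nonempty) →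
      ∃ i ∈ S, ∃ j ∈ T, c i = d j ∧ R (S.erase i) (T.erase j))
    (S : Finset ι) (T : Finset κ) (h : R S T) (l : L) :
    (S.filter (fun i => c i = l)).card = (T.filter (fun i => d i = l)).card := by
  induction hn : S.card generalizing S T with
  | zero =>
    have hS := Finset.card_eq_zero.1 hn
    subst hS
    rcases T.eq_empty_or_nonempty with rfl | hT
    · simp
    · obtain ⟨i, hi, -⟩ := step _ _ h (Or.inr hT)
      simp at hi
  | succ n ih =>
    obtain ⟨i, hi, j, hj, hij, hR⟩ := step S T h (Or.inl (Finset.card_pos.1 (by omega)))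
    have h1 := ih _ _ hR (by rw [Finset.card_erase_of_mem hi]; omega)
    conv_lhs => rw [← Finset.insert_erase hi]
    conv_rhs => rw [← Finset.insert_erase hj]
    rw [Finset.filter_insert, Finset.filter_insert, hij]
    split_ifs
    · rw [Finset.card_insert_of_notMem (by simp), Finset.card_insert_of_notMem (by simp), h1]
    · exact h1

end Labels

/-! ### Sums of positive weights -/

section Sums

variable {Ω : Type u} {ω : Ω → ℝ}

theorem sum_le_sum_of_subset_pos (hω : ∀ i, 0 < ω i) {I J : Finset Ω} (h : I ⊆ J) : ∑ i ∈ I, ω i ≤ ∑ i ∈ J, ω i :=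
  Finset.sum_le_sum_of_subset_of_nonneg h fun i _ _ => (hω i).le

theorem eq_of_subset_of_sum_le (hω : ∀ i, 0 < ω i) {I J : Finset Ω} (h : I ⊆ J)
    (h' : ∑ i ∈ J, ω i ≤ ∑ i ∈ I, ω i) : I = J := by
  by_contra hne
  obtain ⟨j, hj, hjI⟩ := Finset.exists_of_ssubset (h.ssubset_of_ne hne)
  exact absurd (Finset.sum_lt_sum_of_subset h hj hjI (hω j) fun i _ _ => (hω i).le) (not_lt.2 h')

theorem sum_eq_of_perm (σ : Ω ≃ Ω) (hσ : ∀ i, ω (σ i) = ω i) {I J : Finset Ω}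
    (h : ∀ i, i ∈ I ↔ σ i ∈ J) : ∑ i ∈ I, ω i = ∑ i ∈ J, ω i :=
  Finset.sum_equiv σ h fun i _ => (hσ i).symm


end Sums

/-! ### Ideals generated by supports, and their weights -/

section Weights

variable {Ω : Type u} [Fintype Ω] {H : Ω → Type v} [∀ i, AddCommGroup (H i)]
  (P : PartialOrder Ω) (ω : Ω → ℝ)

open Classical in
/-- The ideal generated by the support of `β`, as a finite set. -/
noncomputable def idl (β : ∀ i, H i) : Finset Ω :=
  Finset.univ.filter (fun i => i ∈ idealGen P (supp β))

variable {P} in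
theorem mem_idl {β : ∀ i, H i} {i : Ω} : i ∈ idl P β ↔ ∃ b, β b ≠ 0 ∧ P.le i b := by
  simp only [idl, Finset.mem_filter_univ]
  rfl

theorem wt_eq_sum_idl (β : ∀ i, H i) : wt P ω β = ∑ i ∈ idl P β, ω i := rfl

theorem mem_idl_self {β : ∀ i, H i} {i : Ω} (h : β i ≠ 0) : i ∈ idl P β :=
  mem_idl.2 ⟨i, h, P.le_refl i⟩

variable {P} in
theorem mem_idl_of_le {β : ∀ i, H i} {i j : Ω} (h : j ∈ idl P β) (hij : P.le i j) :
    i ∈ idl P β := by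
  obtain ⟨b, hb, hjb⟩ := mem_idl.1 h
  exact mem_idl.2 ⟨b, hb, P.le_trans _ _ _ hij hjb⟩

theorem isIdeal_idl (β : ∀ i, H i) : IsIdeal P (idl P β : Set Ω) :=
  fun _ hb _ hab => mem_idl_of_le hb hab

theorem supp_subset_iff_idl_subset {β : ∀ i, H i} {I : Finset Ω} (hI : IsIdeal P (I : Set Ω)) :
    (∀ i, β i ≠ 0 → i ∈ I) ↔ idl P β ⊆ I := by
  constructor
  · intro h i hi
    obtain ⟨b, hb, hib⟩ := mem_idl.1 hi
    exact hI b (h b hb) i hib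
  · exact fun h i hi => h (mem_idl_self P hi)

theorem idl_zero : idl P (0 : ∀ i, H i) = ∅ := by
  ext i
  simp [mem_idl]

theorem wt_zero : wt P ω (0 : ∀ i, H i) = 0 := by
  rw [wt_eq_sum_idl, idl_zero, Finset.sum_empty]

theorem idl_congr {α β : ∀ i, H i} (h : ∀ i, α i = 0 ↔ β i = 0) : idl P α = idl P β := by
  ext i
  simp only [mem_idl, ne_eq, h]

theorem wt_congr {α β : ∀ i, H i} (h : ∀ i, α i = 0 ↔ β i = 0) : wt P ω α = wt P ω β := by
  rw [wt_eq_sum_idl, wt_eq_sum_idl, idl_congr P h]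

theorem wt_neg (α : ∀ i, H i) : wt P ω (-α) = wt P ω α :=
  wt_congr P ω (by simp)

theorem wt_smul {S : Type w} [DivisionRing S] [∀ i, Module S (H i)] {c : S} (hc : c ≠ 0)
    (α : ∀ i, H i) : wt P ω (c • α) = wt P ω α :=
  wt_congr P ω (by simp [hc])

variable {ω}

theorem wt_le_wt (hω : ∀ i, 0 < ω i) {α β : ∀ i, H i} (h : idl P α ⊆ idl P β) : wt P ω α ≤ wt P ω β :=
  sum_le_sum_of_subset_pos hω h

theorem idl_eq_of_wt_le (hω : ∀ i, 0 < ω i) {α β : ∀ i, H i} (h : idl P α ⊆ idl P β) (h' : wt P ω β ≤ wt P ω α) :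
    idl P α = idl P β :=
  eq_of_subset_of_sum_le hω h h'

theorem eq_zero_of_wt_eq_zero (hω : ∀ i, 0 < ω i) {α : ∀ i, H i} (h : wt P ω α = 0) : α = 0 := by
  have := idl_eq_of_wt_le (α := 0) (β := α) P hω (by simp [idl_zero])
    (by rw [h, wt_zero])
  funext i
  by_contra hi
  have h2 := mem_idl_self P hi
  rw [← this, idl_zero] at h2
  simp at h2

theorem wt_eq_of_perm (σ : Ω ≃ Ω) (hσ : ∀ i, ω (σ i) = ω i) {α β : ∀ i, H i}
    (h : ∀ i, i ∈ idl P β ↔ σ i ∈ idl P α) : wt P ω β = wt P ω α :=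
  sum_eq_of_perm σ hσ h

theorem exists_idl_eq [∀ i, Nontrivial (H i)] {I : Finset Ω} (hI : IsIdeal P (I : Set Ω)) :
    ∃ β : ∀ i, H i, (∀ i, β i ≠ 0 ↔ i ∈ I) ∧ idl P β = I := by
  classical
  choose e he using fun i => exists_ne (0 : H i)
  have h1 : ∀ i, (fun i => if i ∈ I then e i else 0 : ∀ i, H i) i ≠ 0 ↔ i ∈ I := by
    intro i
    by_cases h : i ∈ I <;> simp [h, he]
  refine ⟨_, h1, Finset.Subset.antisymm ?_ fun i hi => mem_idl_self P ((h1 i).2 hi)⟩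
  exact (supp_subset_iff_idl_subset P hI).1 fun i hi => (h1 i).1 hi

end Weights

/-! ### Triangular isometries, and transitivity -/

section Isometries

variable {Ω : Type u} [Fintype Ω] {F : Type w} [Field F] {H : Ω → Type v}
  [∀ i, AddCommGroup (H i)] [∀ i, Module F (H i)] (P : PartialOrder Ω) {ω : Ω → ℝ}

theorem exists_isometry_of_wt [∀ i, FiniteDimensional F (H i)] (hω : ∀ i, 0 < ω i)
    (φ : (∀ i, H i) →ₗ[F] (∀ i, H i)) (h : ∀ α, wt P ω (φ α) = wt P ω α) :
    ∃ ψ : (∀ i, H i) ≃ₗ[F] (∀ i, H i), IsWeightIsometry F P ω ψ ∧ ∀ α, ψ α = φ α := by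
  have hinj : Function.Injective φ := by
    rw [injective_iff_map_eq_zero]
    intro α hα
    refine eq_zero_of_wt_eq_zero P hω ?_
    rw [← h, hα, wt_zero]
  exact ⟨LinearEquiv.ofInjectiveEndo φ hinj, fun α => h α, fun α => rfl⟩

variable {P} in
/-- A map that is triangular with respect to the order, up to an automorphism, moves the ideal
generated by the support by that automorphism. -/
theorem mem_idl_of_triangular (s : P.le ≃r P.le) {α β : ∀ i, H i}
    (h : ∀ i, (∀ j, P.le (s i) j → j ≠ s i → α j = 0) → (β i = 0 ↔ α (s i) = 0)) (i : Ω) :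
    i ∈ idl P β ↔ s i ∈ idl P α := by
  constructor
  · intro hi
    obtain ⟨b, hb, hib⟩ := mem_idl.1 hi
    refine mem_idl_of_le (j := s b) ?_ (s.map_rel_iff.2 hib)
    by_contra hs
    have h0 : ∀ j, P.le (s b) j → α j = 0 := fun j hj => by
      by_contra hne
      exact hs (mem_idl.2 ⟨j, hne, hj⟩)
    exact hb ((h b fun j hj _ => h0 j hj).2 (h0 _ (P.le_refl _)))
  · intro hi
    obtain ⟨c, hc, hic⟩ := mem_idl.1 hi
    -- At a maximal nonzero coordinate of `α` nothing above interferes, so triangularity transfers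
    -- nonvanishing to `β`.
    obtain ⟨b, hcb, hb, hmax⟩ := exists_maximal_above P (p := fun j => α j ≠ 0) hc
    obtain ⟨b, rfl⟩ := s.surjective b
    refine mem_idl.2 ⟨b, ?_, s.map_rel_iff.1 (P.le_trans _ _ _ hic hcb)⟩
    rw [ne_eq, h b fun j hj hne => ?_]
    · exact hb
    · by_contra h0
      exact hne (hmax j hj h0)

/-- Nonzero scalars do not change supports, so sending `c • γ` to `c • θ` preserves weight on the
line through `γ` and can be extended. -/
theorem transitive_of_MEP (hω : ∀ i, 0 < ω i) (h : MEP F H P ω) :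
    IsometriesTransitive F H P ω := by
  intro γ θ hγθ
  by_cases h0 : γ = 0
  · subst h0
    rw [wt_zero] at hγθ
    have := eq_zero_of_wt_eq_zero P hω hγθ.symm
    subst this
    exact ⟨LinearEquiv.refl F _, fun _ => rfl, rfl⟩
  · let e := LinearEquiv.toSpanNonzeroSingleton F (∀ i, H i) γ h0
    obtain ⟨φ, hφ, hf⟩ := h (Submodule.span F {γ})
      ((LinearMap.toSpanSingleton F (∀ i, H i) θ) ∘ₗ e.symm.toLinearMap) (by
        intro α
        obtain ⟨c, rfl⟩ := e.surjective α
        have h1 : ((e c : Submodule.span F {γ}) : ∀ i, H i) = c • γ := rfl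
        simp only [LinearMap.comp_apply, LinearEquiv.coe_coe, LinearEquiv.symm_apply_apply, h1,
          LinearMap.toSpanSingleton_apply]
        by_cases hc : c = 0
        · simp [hc]
        · rw [wt_smul P ω hc, wt_smul P ω hc, hγθ])
    refine ⟨φ, hφ, ?_⟩
    have := hf (e 1)
    have h1 : ((e 1 : Submodule.span F {γ}) : ∀ i, H i) = γ := one_smul F γ
    rw [h1] at this
    rw [this]
    simp

theorem exists_linearEquiv_apply_eq {V W : Type*} [AddCommGroup V] [Module F V]
    [AddCommGroup W] [Module F W] [FiniteDimensional F V] (e : V ≃ₗ[F] W) {x : V} {y : W}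
    (hx : x ≠ 0) (hy : y ≠ 0) : ∃ g : V ≃ₗ[F] W, g x = y := by
  have hy' : e.symm y ≠ 0 := by simpa using hy
  let p := LinearEquiv.toSpanNonzeroSingleton F V x hx
  obtain ⟨g, hg⟩ := Submodule.exists_linearEquiv_restrict_eq
    (p.symm.trans (LinearEquiv.toSpanNonzeroSingleton F V (e.symm y) hy'))
  refine ⟨g.trans e, ?_⟩
  have h1 := hg (p 1)
  have h2 : ((p 1 : Submodule.span F {x}) : V) = x := one_smul F x
  rw [h2, LinearEquiv.trans_apply, p.symm_apply_apply] at h1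
  rw [LinearEquiv.trans_apply, ← h1]
  simp

theorem exists_linearMap_apply_eq {V W : Type*} [AddCommGroup V] [Module F V]
    [AddCommGroup W] [Module F W] {x : V} (hx : x ≠ 0) (y : W) : ∃ g : V →ₗ[F] W, g x = y := by
  obtain ⟨g, hg⟩ := LinearMap.exists_extend (p := Submodule.span F {x})
    ((LinearMap.toSpanSingleton F W y) ∘ₗ
      (LinearEquiv.toSpanNonzeroSingleton F V x hx).symm.toLinearMap)
  refine ⟨g, ?_⟩
  have h1 := LinearMap.congr_fun hg (LinearEquiv.toSpanNonzeroSingleton F V x hx 1)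
  rw [LinearMap.comp_apply, LinearMap.comp_apply, LinearEquiv.coe_coe,
    LinearEquiv.symm_apply_apply] at h1
  simpa using h1

/-- Condition (D) matches the two ideals by an automorphism. Over it one builds a map whose `i`-th
component is an isomorphism applied to coordinate `s i`, plus a correction `N i` that sees only
coordinates strictly above `s i`; every such map is an isometry, and the components can be adjusted
one at a time to send `γ` to `θ`. -/
theorem transitive_of_conditionD [∀ i, FiniteDimensional F (H i)] (hω : ∀ i, 0 < ω i)
    (h : ConditionD F H P ω) : IsometriesTransitive F H P ω := by
  classical
  intro γ θ hγθ
  obtain ⟨l, hl, hlω⟩ := h.1 (idl P γ) (idl P θ) (isIdeal_idl P γ) (isIdeal_idl P θ) hγθ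
  let s := l.symm
  have hsω : ∀ i, ω (s i) = ω i := fun i => by
    rw [← hlω (s i)]
    exact congrArg ω (l.apply_symm_apply i)
  have hs : ∀ i, i ∈ idl P θ ↔ s i ∈ idl P γ := by
    intro i
    rw [← Finset.mem_coe, hl]
    constructor
    · rintro ⟨j, hj, rfl⟩
      simpa [s] using hj
    · intro hi
      exact ⟨s i, hi, l.apply_symm_apply i⟩
  have key : ∀ i, ∃ g : H (s i) ≃ₗ[F] H i, ∃ N : (∀ i, H i) →ₗ[F] H i,
      (∀ α : ∀ i, H i, (∀ j, P.le (s i) j → j ≠ s i → α j = 0) → N α = 0) ∧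
      g (γ (s i)) + N γ = θ i := by
    intro i
    obtain ⟨g⟩ := h.2 (s i) i (len_apply P s i) (hsω i)
    -- A nonzero coordinate of `γ` strictly above `s i` lets the correction term supply any missing
    -- value.
    by_cases h1 : ∃ b, P.le (s i) b ∧ b ≠ s i ∧ γ b ≠ 0
    · obtain ⟨b, hb, hne, hγb⟩ := h1
      obtain ⟨A, hA⟩ := exists_linearMap_apply_eq (F := F) hγb (θ i - g (γ (s i)))
      refine ⟨g, A ∘ₗ LinearMap.proj b, fun α hα => ?_, ?_⟩
      · simp [hα b hb hne]
      · simp [hA]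
    · push Not at h1
      -- No correction is available here. Inside the ideal, `s i` is maximal, so both `γ (s i)` and
      -- `θ i` are nonzero and the isomorphism itself can be chosen; outside, both vanish.
      by_cases h2 : s i ∈ idl P γ
      · have h3 : γ (s i) ≠ 0 := by
          obtain ⟨b, hb, hib⟩ := mem_idl.1 h2
          by_cases e : b = s i
          · exact e ▸ hb
          · exact absurd (h1 b hib e) hb
        have h4 : θ i ≠ 0 := by
          obtain ⟨c, hc, hic⟩ := mem_idl.1 ((hs i).2 h2)
          obtain ⟨b, hb, hcb⟩ := mem_idl.1 ((hs c).1 (mem_idl_self P hc))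
          have h5 : P.le (s i) (s c) := s.map_rel_iff.2 hic
          have h6 : b = s i := by
            by_contra e
            exact hb (h1 b (P.le_trans _ _ _ h5 hcb) e)
          rw [h6] at hcb
          have h7 := s.injective (P.le_antisymm _ _ h5 hcb)
          exact h7 ▸ hc
        obtain ⟨g', hg'⟩ := exists_linearEquiv_apply_eq g h3 h4
        exact ⟨g', 0, fun _ _ => rfl, by simp [hg']⟩
      · have h3 : γ (s i) = 0 := by
          by_contra h3
          exact h2 (mem_idl_self P h3)
        have h4 : θ i = 0 := by
          by_contra h4
          exact h2 ((hs i).1 (mem_idl_self P h4))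
        exact ⟨g, 0, fun _ _ => rfl, by simp [h3, h4]⟩
  choose g N hN hgN using key
  obtain ⟨ψ, hψ, hψ'⟩ := exists_isometry_of_wt P hω
    (LinearMap.pi fun i => (g i).toLinearMap ∘ₗ LinearMap.proj (s i) + N i) (by
      intro α
      refine wt_eq_of_perm P s.toEquiv hsω (mem_idl_of_triangular s fun i hi => ?_)
      simp [hN i α hi])
  refine ⟨ψ, hψ, ?_⟩
  rw [hψ']
  funext i
  exact hgN i

end Isometries

/-! ### Recovering the order from the weight -/

section Principal

variable {Ω : Type u} [Fintype Ω] {H : Ω → Type v} [∀ i, AddCommGroup (H i)]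
  (P : PartialOrder Ω) {ω : Ω → ℝ}

/-- The support of `α` has the greatest element `i`. -/
def HasTop (α : ∀ i, H i) (i : Ω) : Prop :=
  α i ≠ 0 ∧ ∀ b, α b ≠ 0 → P.le b i

variable {P}

theorem HasTop.mem_idl_iff {α : ∀ i, H i} {i : Ω} (h : HasTop P α i) {j : Ω} :
    j ∈ idl P α ↔ P.le j i := by
  rw [mem_idl]
  constructor
  · rintro ⟨b, hb, hjb⟩
    exact P.le_trans _ _ _ hjb (h.2 b hb)
  · exact fun hj => ⟨i, h.1, hj⟩

theorem hasTop_single [DecidableEq Ω] {i : Ω} {x : H i} (hx : x ≠ 0) :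
    HasTop P (Pi.single i x) i := by
  refine ⟨by simpa using hx, fun b hb => ?_⟩
  by_cases e : b = i
  · exact e ▸ P.le_refl _
  · exact absurd (Pi.single_eq_of_ne e x) hb

theorem HasTop.wt_eq [DecidableRel P.le] {α : ∀ i, H i} {i : Ω} (h : HasTop P α i) :
    wt P ω α = ∑ j ∈ Finset.univ.filter (fun j => P.le j i), ω j := by
  rw [wt_eq_sum_idl]
  congr 1
  ext j
  rw [h.mem_idl_iff, Finset.mem_filter_univ]

/-- If `j` is not below `i`, either `i` lies strictly below `j`, and `β` is heavier than `α`, or the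
tops are incomparable; then neither cancels in `α + β`, whose ideal properly contains that of `α`.
-/
theorem HasTop.le_iff (hω : ∀ i, 0 < ω i) {α β : ∀ i, H i} {i j : Ω} (hα : HasTop P α i)
    (hβ : HasTop P β j) : P.le j i ↔ wt P ω β ≤ wt P ω α ∧ wt P ω (α + β) ≤ wt P ω α := by
  constructor
  · intro hji
    have h1 : idl P β ⊆ idl P α := fun b hb =>
      hα.mem_idl_iff.2 (P.le_trans _ _ _ (hβ.mem_idl_iff.1 hb) hji)
    refine ⟨wt_le_wt P hω h1, wt_le_wt P hω ?_⟩
    refine (supp_subset_iff_idl_subset P (isIdeal_idl P α)).1 fun b hb => ?_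
    by_cases h2 : α b = 0
    · refine h1 (mem_idl_self P fun h3 => hb ?_)
      simp [h2, h3]
    · exact mem_idl_self P h2
  · rintro ⟨h1, h2⟩
    by_contra hji
    by_cases hij : P.le i j
    · have h3 : idl P α ⊆ idl P β := fun b hb =>
        hβ.mem_idl_iff.2 (P.le_trans _ _ _ (hα.mem_idl_iff.1 hb) hij)
      have h4 := idl_eq_of_wt_le P hω h3 h1
      exact hji (hα.mem_idl_iff.1 (h4 ▸ mem_idl_self P hβ.1))
    · have hαj : α j = 0 := by
        by_contra h
        exact hji (hα.2 j h)
      have hβi : β i = 0 := by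
        by_contra h
        exact hij (hβ.2 i h)
      have hi : (α + β) i ≠ 0 := by simpa [hβi] using hα.1
      have hj : (α + β) j ≠ 0 := by simpa [hαj] using hβ.1
      have h3 : idl P α ⊆ idl P (α + β) := fun b hb =>
        mem_idl.2 ⟨i, hi, hα.mem_idl_iff.1 hb⟩
      have h4 := idl_eq_of_wt_le P hω h3 h2
      exact hji (hα.mem_idl_iff.1 (h4 ▸ mem_idl_self P hj))

/-- Coordinate `i` vanishes on every vector lighter than a vector with top `i`, hence on their span.
Without a top, `α` is the sum of its block components, and each nonzero one generates a strictly
smaller ideal. The right-hand side involves only linearity and weight, so isometries preserve it. -/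
theorem exists_hasTop_iff {F : Type w} [Field F] [∀ i, Module F (H i)] (hω : ∀ i, 0 < ω i)
    (α : ∀ i, H i) : (∃ i, HasTop P α i) ↔
      α ∉ Submodule.span F {β : ∀ i, H i | wt P ω β < wt P ω α} := by
  classical
  constructor
  · rintro ⟨i, hi⟩ hα
    have h1 : Submodule.span F {β : ∀ i, H i | wt P ω β < wt P ω α} ≤
        LinearMap.ker (LinearMap.proj (R := F) (φ := H) i) := by
      rw [Submodule.span_le]
      intro β hβ
      by_contra h0
      refine absurd (wt_le_wt (α := α) (β := β) P hω fun b hb => ?_) (not_le.2 hβ)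
      exact mem_idl.2 ⟨i, by simpa using h0, hi.mem_idl_iff.1 hb⟩
    exact hi.1 (by simpa using h1 hα)
  · intro hα
    by_contra hno
    apply hα
    rw [show α = ∑ i, Pi.single i (α i) from (Finset.univ_sum_single α).symm]
    refine Submodule.sum_mem _ fun i _ => ?_
    rw [Finset.univ_sum_single]
    by_cases h0 : α i = 0
    · simp [h0]
    · refine Submodule.subset_span ?_
      by_contra hlt
      have ht := hasTop_single (P := P) h0
      have h1 : idl P (Pi.single i (α i)) ⊆ idl P α := fun b hb =>
        mem_idl.2 ⟨i, h0, ht.mem_idl_iff.1 hb⟩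
      have h2 := idl_eq_of_wt_le P hω h1 (not_lt.1 hlt)
      exact hno ⟨i, h0, fun b hb => ht.mem_idl_iff.1 (h2 ▸ mem_idl_self P hb)⟩

theorem HasTop.exists_map {F : Type w} [Field F] [∀ i, Module F (H i)] (hω : ∀ i, 0 < ω i)
    {φ : (∀ i, H i) ≃ₗ[F] (∀ i, H i)} (hφ : IsWeightIsometry F P ω φ) {α : ∀ i, H i} {i : Ω}
    (h : HasTop P α i) : ∃ j, HasTop P (φ α) j := by
  rw [exists_hasTop_iff (F := F) hω]
  have h1 := (exists_hasTop_iff (F := F) hω α).1 ⟨i, h⟩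
  have h2 : {β : ∀ i, H i | wt P ω β < wt P ω (φ α)} = φ '' {β | wt P ω β < wt P ω α} := by
    ext β
    constructor
    · intro hβ
      refine ⟨φ.symm β, ?_, φ.apply_symm_apply β⟩
      have := hφ (φ.symm β)
      rw [φ.apply_symm_apply] at this
      rw [Set.mem_ofPred_eq, ← this, ← hφ α]
      exact hβ
    · rintro ⟨β, hβ, rfl⟩
      rw [Set.mem_ofPred_eq, hφ, hφ]
      exact hβ
  rw [h2, ← LinearEquiv.coe_coe, Submodule.span_image, Submodule.mem_map]
  rintro ⟨β, hβ, he⟩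
  exact h1 (φ.injective he ▸ hβ)

/-- Every isometry induces a weight-preserving order automorphism. -/
theorem IsWeightIsometry.exists_relIso {F : Type w} [Field F] [∀ i, Module F (H i)]
    [∀ i, Nontrivial (H i)] (hω : ∀ i, 0 < ω i)
    {φ : (∀ i, H i) ≃ₗ[F] (∀ i, H i)} (hφ : IsWeightIsometry F P ω φ) :
    ∃ l : P.le ≃r P.le, (∀ i, ω (l i) = ω i) ∧
      ∀ (α : ∀ i, H i) i, l i ∈ idl P (φ α) ↔ i ∈ idl P α := by
  classical
  choose e he using fun i => exists_ne (0 : H i)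
  choose t ht using fun i => (hasTop_single (P := P) (he i)).exists_map hω hφ
  have hle : ∀ {α β : ∀ i, H i} {i j i' j' : Ω}, HasTop P α i → HasTop P β j →
      HasTop P (φ α) i' → HasTop P (φ β) j' → (P.le j' i' ↔ P.le j i) := by
    intro α β i j i' j' h1 h2 h3 h4
    rw [h1.le_iff hω h2, h3.le_iff hω h4, hφ, hφ, ← map_add, hφ]
  have htle : ∀ i j, P.le (t j) (t i) ↔ P.le j i := fun i j =>
    hle (hasTop_single (he i)) (hasTop_single (he j)) (ht i) (ht j)
  have hinj : Function.Injective t := fun i j hij =>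
    P.le_antisymm _ _ ((htle j i).1 (hij ▸ P.le_refl _)) ((htle i j).1 (hij ▸ P.le_refl _))
  let l : P.le ≃r P.le :=
    ⟨Equiv.ofBijective t (Finite.injective_iff_bijective.1 hinj), fun {a b} => htle b a⟩
  have hl : ∀ i, l i = t i := fun i => rfl
  have hlω : ∀ i, ω (l i) = ω i := by
    refine apply_eq_of_sum_principal_eq P l ω fun i => ?_
    rw [hl, ← (ht i).wt_eq, hφ, (hasTop_single (he i)).wt_eq]
  -- The image top depends only on `i`: two vectors with the same top have images whose tops are
  -- below each other.
  have htop : ∀ i (x : H i), x ≠ 0 → HasTop P (φ (Pi.single i x)) (l i) := by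
    intro i x hx
    obtain ⟨j, hj⟩ := (hasTop_single (P := P) hx).exists_map hω hφ
    have h1 := (hle (hasTop_single (he i)) (hasTop_single hx) (ht i) hj).2 (P.le_refl _)
    have h2 := (hle (hasTop_single hx) (hasTop_single (he i)) hj (ht i)).2 (P.le_refl _)
    rw [hl, ← P.le_antisymm _ _ h1 h2]
    exact hj
  refine ⟨l, hlω, fun α i => ?_⟩
  have hI : IsIdeal P (((idl P α).map l.toEquiv.toEmbedding : Finset Ω) : Set Ω) := by
    intro b hb a hab
    simp only [Finset.coe_map, Set.mem_image, Finset.mem_coe] at hb ⊢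
    obtain ⟨c, hc, rfl⟩ := hb
    obtain ⟨a, rfl⟩ := l.surjective a
    exact ⟨a, mem_idl_of_le hc (l.map_rel_iff.1 hab), rfl⟩
  -- Expanding `α` into blocks gives one inclusion; the equality of weights then forces equality.
  have h1 : idl P (φ α) ⊆ (idl P α).map l.toEquiv.toEmbedding := by
    refine (supp_subset_iff_idl_subset P hI).1 fun b hb => ?_
    rw [← Finset.univ_sum_single α, map_sum, Finset.sum_apply] at hb
    obtain ⟨i, -, hi⟩ := Finset.exists_ne_zero_of_sum_ne_zero hb
    have h0 : α i ≠ 0 := by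
      intro h0
      simp [h0] at hi
    refine hI (l i) ?_ b ((htop i _ h0).2 b hi)
    exact Finset.mem_map_of_mem _ (mem_idl_self P h0)
  have h2 := eq_of_subset_of_sum_le hω h1 (by
    rw [Finset.sum_map]
    have := hφ α
    rw [wt_eq_sum_idl, wt_eq_sum_idl] at this
    rw [this]
    exact (Finset.sum_congr rfl fun i _ => hlω i).le)
  rw [h2]
  simp only [Finset.mem_map_equiv]
  constructor
  · intro h
    simpa using h
  · intro h
    simpa using h

/-- Vectors supported below `i` are carried injectively to vectors supported below `l i`. This gives
one inequality of dimensions for each principal ideal; inversion over principal ideals extracts the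
dimension of a single block. -/
theorem finrank_apply_eq {F : Type w} [Field F] [∀ i, Module F (H i)]
    [∀ i, FiniteDimensional F (H i)]
    {φ : (∀ i, H i) ≃ₗ[F] (∀ i, H i)} {l : P.le ≃r P.le}
    (hl : ∀ (α : ∀ i, H i) i, l i ∈ idl P (φ α) ↔ i ∈ idl P α) (i : Ω) :
    Module.finrank F (H (l i)) = Module.finrank F (H i) := by
  classical
  let ext (p : Ω → Prop) : (∀ j : {j // p j}, H j) →ₗ[F] (∀ j, H j) :=
    LinearMap.pi fun j => if h : p j then LinearMap.proj (⟨j, h⟩ : {j // p j}) else 0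
  have ext_pos : ∀ (p : Ω → Prop) x j (h : p j), ext p x j = x ⟨j, h⟩ := by
    intro p x j h
    simp [ext, h]
  have ext_neg : ∀ (p : Ω → Prop) x j (_ : ¬ p j), ext p x j = 0 := by
    intro p x j h
    simp [ext, h]
  have hD : ∀ i, Module.finrank F (∀ j : {j // P.le j i}, H j) ≤
      Module.finrank F (∀ j : {j // P.le j (l i)}, H j) := by
    intro i
    refine LinearMap.finrank_le_finrank_of_injective
      (f := (LinearMap.pi fun j : {j // P.le j (l i)} => LinearMap.proj j.1) ∘ₗ φ.toLinearMap ∘ₗ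
        ext (fun j => P.le j i)) ?_
    rw [injective_iff_map_eq_zero]
    intro x hx
    have h1 : φ (ext _ x) = 0 := by
      funext j
      by_cases hj : P.le j (l i)
      · exact congrFun hx ⟨j, hj⟩
      · by_contra h0
        obtain ⟨j, rfl⟩ := l.surjective j
        obtain ⟨b, hb, hjb⟩ := mem_idl.1 ((hl _ j).1 (mem_idl_self P h0))
        have hbi : P.le b i := by
          by_contra hbi
          exact hb (ext_neg _ x b hbi)
        exact hj (l.map_rel_iff.2 (P.le_trans _ _ _ hjb hbi))
    have h2 := (LinearEquiv.map_eq_zero_iff φ).1 h1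
    funext j
    have h3 := congrFun h2 j.1
    rwa [ext_pos _ x j.1 j.2] at h3
  have hsum : ∀ i, Module.finrank F (∀ j : {j // P.le j i}, H j) =
      ∑ j ∈ Finset.univ.filter (fun j => P.le j i), Module.finrank F (H j) := by
    intro i
    rw [Module.finrank_pi_fintype]
    symm
    exact Finset.sum_subtype _ (by simp) _
  -- The inequalities are equalities because `l` permutes the index set, so both sides have the same
  -- total.
  have heq : ∀ i, Module.finrank F (∀ j : {j // P.le j i}, H j) =
      Module.finrank F (∀ j : {j // P.le j (l i)}, H j) := by
    have := (Finset.sum_eq_sum_iff_of_le (fun i (_ : i ∈ Finset.univ) => hD i)).1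
      (Equiv.sum_comp l.toEquiv
        (fun i => Module.finrank F (∀ j : {j // P.le j i}, H j))).symm
    exact fun i => this i (Finset.mem_univ i)
  have := apply_eq_of_sum_principal_eq P l (fun i => (Module.finrank F (H i) : ℝ)) (fun i => by
    have h := heq i
    rw [hsum, hsum] at h
    exact_mod_cast h.symm) i
  exact_mod_cast this

open Classical in
/-- The elements of length less than that of `u`, together with `u`. -/
noncomputable def lowerWith (P : PartialOrder Ω) (u : Ω) : Finset Ω :=
  insert u (Finset.univ.filter fun j => len P j < len P u)

theorem mem_lowerWith {u j : Ω} : j ∈ lowerWith P u ↔ j = u ∨ len P j < len P u := by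
  simp [lowerWith]

theorem isIdeal_lowerWith (u : Ω) : IsIdeal P (lowerWith P u : Set Ω) := by
  intro b hb a hab
  rw [Finset.mem_coe, mem_lowerWith] at hb ⊢
  by_cases e : a = b
  · exact e ▸ hb
  · have := len_lt_len P hab e
    rcases hb with rfl | hb
    · exact Or.inr this
    · exact Or.inr (this.trans hb)

theorem sum_lowerWith_eq {u v : Ω} (h : len P u = len P v) (h' : ω u = ω v) :
    ∑ i ∈ lowerWith P u, ω i = ∑ i ∈ lowerWith P v, ω i := by
  classical
  simp [lowerWith, h, h']

/-- Only `v` has its own length in `lowerWith P v`, and automorphisms preserve length. Such ideals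
let statements about ideals be read at single elements. -/
theorem apply_eq_of_lowerWith {u v : Ω} (h : len P u = len P v) (l : P.le ≃r P.le)
    (hl : ∀ i, l i ∈ lowerWith P v ↔ i ∈ lowerWith P u) : l u = v := by
  have := (hl u).2 (mem_lowerWith.2 (Or.inl rfl))
  rw [mem_lowerWith, len_apply, h] at this
  exact this.resolve_right (lt_irrefl _)

theorem UDP.exists_apply_eq (hU : UDP P ω) {u v : Ω} (h : len P u = len P v) (h' : ω u = ω v) :
    ∃ l : P.le ≃r P.le, l u = v ∧ ∀ i, ω (l i) = ω i := by
  obtain ⟨l, hl, hlω⟩ := hU _ _ (isIdeal_lowerWith u) (isIdeal_lowerWith v) (sum_lowerWith_eq h h')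
  refine ⟨l, apply_eq_of_lowerWith h l fun i => ?_, hlω⟩
  rw [← Finset.mem_coe, hl, l.injective.mem_set_image, Finset.mem_coe]

/-- Every ideal is generated by the support of some vector, so an isometry between two such vectors
induces the required automorphism, which also preserves block dimensions. -/
theorem conditionD_of_transitive {F : Type w} [Field F] [∀ i, Module F (H i)]
    [∀ i, FiniteDimensional F (H i)] [∀ i, Nontrivial (H i)] (hω : ∀ i, 0 < ω i)
    (h : IsometriesTransitive F H P ω) : ConditionD F H P ω := by
  have key : ∀ I J : Finset Ω, IsIdeal P (I : Set Ω) → IsIdeal P (J : Set Ω) →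
      ∑ i ∈ I, ω i = ∑ j ∈ J, ω j → ∃ l : P.le ≃r P.le, (∀ i, l i ∈ J ↔ i ∈ I) ∧
        (∀ i, ω (l i) = ω i) ∧ ∀ i, Module.finrank F (H (l i)) = Module.finrank F (H i) := by
    intro I J hI hJ hIJ
    obtain ⟨γ, -, hγ⟩ := exists_idl_eq (H := H) P hI
    obtain ⟨θ, -, hθ⟩ := exists_idl_eq (H := H) P hJ
    obtain ⟨ψ, hψ, hψγ⟩ := h γ θ (by rw [wt_eq_sum_idl, wt_eq_sum_idl, hγ, hθ, hIJ])
    obtain ⟨l, hlω, hl⟩ := hψ.exists_relIso hω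
    refine ⟨l, fun i => ?_, hlω, finrank_apply_eq hl⟩
    rw [← hγ, ← hθ, ← hψγ, hl]
  refine ⟨fun I J hI hJ hIJ => ?_, fun u v huv hω' => ?_⟩
  · obtain ⟨l, hl, hlω, -⟩ := key I J hI hJ hIJ
    refine ⟨l, ?_, hlω⟩
    ext j
    constructor
    · intro hj
      exact ⟨l.symm j, (hl _).1 (by simpa using hj), l.apply_symm_apply j⟩
    · rintro ⟨i, hi, rfl⟩
      exact (hl i).2 hi
  · obtain ⟨l, hl, -, hlk⟩ := key _ _ (isIdeal_lowerWith u) (isIdeal_lowerWith v)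
      (sum_lowerWith_eq huv hω')
    have h1 := apply_eq_of_lowerWith huv l hl
    refine ⟨LinearEquiv.ofFinrankEq _ _ ?_⟩
    rw [← hlk u, h1]

end Principal

/-! ### Passing to the dual poset by complements -/

section DualPoset

variable {Ω : Type u} [Fintype Ω] {P : PartialOrder Ω} {ω : Ω → ℝ}

theorem isIdeal_compl_dualPoset [DecidableEq Ω] {I : Finset Ω} (hI : IsIdeal P (I : Set Ω)) :
    IsIdeal (dualPoset P) ((Iᶜ : Finset Ω) : Set Ω) := by
  intro b hb a hab
  rw [Finset.mem_coe, Finset.mem_compl] at hb ⊢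
  exact fun ha => hb (hI a ha b hab)

/-- An order automorphism, seen as one of the dual poset. -/
def relIsoDual (l : P.le ≃r P.le) : (dualPoset P).le ≃r (dualPoset P).le :=
  ⟨l.toEquiv, fun {_ _} => l.map_rel_iff⟩

/-- An order automorphism of the dual poset, seen as one of the poset. -/
def relIsoOfDual (l : (dualPoset P).le ≃r (dualPoset P).le) : P.le ≃r P.le :=
  ⟨l.toEquiv, fun {_ _} => l.map_rel_iff⟩

theorem UDP.dual (h : UDP P ω) : UDP (dualPoset P) ω := by
  classical
  intro I J hI hJ hIJ
  have hc : ∀ I : Finset Ω, ∑ i ∈ Iᶜ, ω i = ∑ i, ω i - ∑ i ∈ I, ω i := fun I =>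
    eq_sub_of_add_eq' (Finset.sum_add_sum_compl I ω)
  obtain ⟨l, hl, hlω⟩ := h Iᶜ Jᶜ (isIdeal_compl_dualPoset hI) (isIdeal_compl_dualPoset hJ)
    (by rw [hc, hc, hIJ])
  refine ⟨relIsoDual l, ?_, hlω⟩
  rw [Finset.coe_compl, Finset.coe_compl, Set.image_compl_eq l.bijective] at hl
  exact compl_injective hl

/-- Lengths in `P` and in its dual are unrelated in general. The dual decomposition property,
however, moves `u` to `v` by an automorphism, and this forces equal lengths in `P`. -/
theorem ConditionD.dual {F : Type w} [Ring F] {H : Ω → Type v} [∀ i, AddCommGroup (H i)]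
    [∀ i, Module F (H i)] (h : ConditionD F H P ω) : ConditionD F H (dualPoset P) ω := by
  refine ⟨h.1.dual, fun u v huv huv' => ?_⟩
  obtain ⟨l, hl, -⟩ := h.1.dual.exists_apply_eq huv huv'
  refine h.2 u v ?_ huv'
  rw [← hl]
  exact (len_apply P (relIsoOfDual l) u).symm

theorem range_wt_dual {H : Ω → Type v} [∀ i, AddCommGroup (H i)] [∀ i, Nontrivial (H i)] :
    Set.range (wt (H := H) (dualPoset P) ω) =
      (fun x => ∑ i, ω i - x) '' Set.range (wt (H := H) P ω) := by
  classical
  have hc : ∀ I : Finset Ω, ∑ i ∈ Iᶜ, ω i = ∑ i, ω i - ∑ i ∈ I, ω i := fun I =>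
    eq_sub_of_add_eq' (Finset.sum_add_sum_compl I ω)
  ext x
  constructor
  · rintro ⟨β, rfl⟩
    obtain ⟨γ, -, hγ⟩ := exists_idl_eq (H := H) P
      (isIdeal_compl_dualPoset (P := dualPoset P) (isIdeal_idl (dualPoset P) β))
    refine ⟨_, ⟨γ, rfl⟩, ?_⟩
    simp only [wt_eq_sum_idl, hγ, hc]
    ring
  · rintro ⟨_, ⟨β, rfl⟩, rfl⟩
    obtain ⟨γ, -, hγ⟩ := exists_idl_eq (H := H) (dualPoset P)
      (isIdeal_compl_dualPoset (isIdeal_idl P β))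
    refine ⟨γ, ?_⟩
    simp only [wt_eq_sum_idl, hγ, hc]

/-- Complementing ideals turns a weight `x` into the total weight minus `x`, an injective operation
on the attained weights. -/
theorem card_quotient_weightPartition_dual (H : Ω → Type v) [∀ i, AddCommGroup (H i)]
    [∀ i, Nontrivial (H i)] :
    Nat.card (Quotient (weightPartition H (dualPoset P) ω)) =
      Nat.card (Quotient (weightPartition H P ω)) := by
  unfold weightPartition
  rw [Nat.card_congr (Setoid.quotientKerEquivRange _),
    Nat.card_congr (Setoid.quotientKerEquivRange _), range_wt_dual, Nat.card_coe_set_eq,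
    Nat.card_coe_set_eq]
  exact Set.ncard_image_of_injective _ sub_right_injective

end DualPoset

/-- The natural surjection between finite quotients is injective once the target is at least as
large. This is how inclusions of partitions are upgraded to equalities. -/
theorem setoid_eq_of_le_of_card {X : Type u} [Finite X] {Γ Δ : Setoid X} (h : Γ ≤ Δ)
    (hc : Nat.card (Quotient Γ) ≤ Nat.card (Quotient Δ)) : Γ = Δ := by
  refine le_antisymm h fun x y hxy => ?_
  have hs : Function.Surjective (Quotient.map' (s₁ := Γ) (s₂ := Δ) id fun a b hab => h hab) := by
    intro q
    induction q using Quotient.inductionOn with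
    | h a => exact ⟨Quotient.mk Γ a, rfl⟩
  have hb := hs.bijective_of_nat_card_le hc
  have : Quotient.mk Γ x = Quotient.mk Γ y := hb.1 (Quotient.sound hxy)
  exact Quotient.exact this

/-! ### Fourier transform, dual partitions and Poisson summation -/

section Fourier

variable {Ω : Type u} [Fintype Ω] {F : Type v} [Field F] {k : Ω → ℕ}

theorem ip_comm (α β : Amb F k) : ip α β = ip β α := by
  simp only [ip, mul_comm]

theorem ip_add_left (α β γ : Amb F k) : ip (α + β) γ = ip α γ + ip β γ := by
  simp only [ip, Pi.add_apply, add_mul, Finset.sum_add_distrib]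

theorem ip_add_right (α β γ : Amb F k) : ip α (β + γ) = ip α β + ip α γ := by
  simp only [ip, Pi.add_apply, mul_add, Finset.sum_add_distrib]

theorem ip_smul_left (c : F) (α β : Amb F k) : ip (c • α) β = c * ip α β := by
  simp only [ip, Pi.smul_apply, smul_eq_mul, mul_assoc, Finset.mul_sum]

theorem ip_smul_right (c : F) (α β : Amb F k) : ip α (c • β) = c * ip α β := by
  rw [ip_comm, ip_smul_left, ip_comm]

theorem ip_zero_right (α : Amb F k) : ip α 0 = 0 := by
  simp [ip]

theorem ip_single [DecidableEq Ω] (i : Ω) (t : Fin (k i)) (β : Amb F k) :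
    ip (Pi.single i (Pi.single t 1)) β = β i t := by
  rw [ip, Finset.sum_eq_single i, Finset.sum_eq_single t]
  · simp
  · intro s _ hs
    simp [hs]
  · simp
  · intro j _ hj
    simp [Pi.single_eq_of_ne hj]
  · simp

theorem eq_zero_of_ip_eq_zero {β : Amb F k} (h : ∀ α : Amb F k, ip α β = 0) : β = 0 := by
  classical
  funext i t
  rw [← ip_single i t β, h]
  rfl

variable [Fintype F] (χ : AddChar F ℂ)

open Classical in
/-- The Fourier transform of a function on the ambient space. -/
noncomputable def fourier (g : Amb F k → ℂ) (α : Amb F k) : ℂ :=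
  ∑ β, g β * χ (ip α β)

open Classical in
theorem charSum_eq_fourier (B : Set (Amb F k)) (α : Amb F k) :
    charSum χ B α = fourier χ (fun β => if β ∈ B then 1 else 0) α := by
  unfold charSum fourier
  rw [Finset.sum_filter]
  simp

theorem exists_ne_one (hχ : χ ≠ 1) : ∃ c, χ c ≠ 1 := by
  by_contra h
  push Not at h
  exact hχ (by ext c; simp [h c])

open Classical in
theorem sum_char_submodule (hχ : χ ≠ 1) (C : Submodule F (Amb F k)) (β : Amb F k) :
    ∑ α ∈ Finset.univ.filter (fun α => α ∈ C), χ (ip α β) =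
      if β ∈ dualCode C then ((Finset.univ.filter (fun α => α ∈ C)).card : ℂ) else 0 := by
  split_ifs with h
  · rw [Finset.sum_congr rfl fun α hα => by
      rw [h α (by simpa using hα), AddChar.map_zero_eq_one]]
    simp
  · simp only [dualCode, Set.mem_ofPred_eq, not_forall] at h
    obtain ⟨α, hα, h0⟩ := h
    obtain ⟨c, hc⟩ := exists_ne_one χ hχ
    have h1 : ∑ x ∈ Finset.univ.filter (fun α => α ∈ C), χ (ip x β) =
        ∑ x ∈ Finset.univ.filter (fun α => α ∈ C), χ c * χ (ip x β) := by
      symm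
      refine Finset.sum_equiv (Equiv.addLeft ((c / ip α β) • α)) ?_ ?_
      · intro x
        simp only [Finset.mem_filter_univ, Equiv.coe_addLeft]
        exact (C.add_mem_iff_right (C.smul_mem _ hα)).symm
      · intro x _
        rw [Equiv.coe_addLeft, ip_add_left, ip_smul_left, div_mul_cancel₀ _ h0,
          AddChar.map_add_eq_mul]
    rw [← Finset.mul_sum] at h1
    have h2 : (χ c - 1) * ∑ x ∈ Finset.univ.filter (fun α => α ∈ C), χ (ip x β) = 0 := by
      rw [sub_mul, one_mul, ← h1, sub_self]
    exact (mul_eq_zero.1 h2).resolve_left (sub_ne_zero.2 hc)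

open Classical in
theorem sum_char (hχ : χ ≠ 1) (β : Amb F k) :
    ∑ α, χ (ip α β) = if β = 0 then (Fintype.card (Amb F k) : ℂ) else 0 := by
  have h := sum_char_submodule χ hχ (⊤ : Submodule F (Amb F k)) β
  have h1 : β ∈ dualCode (⊤ : Submodule F (Amb F k)) ↔ β = 0 :=
    ⟨fun h => eq_zero_of_ip_eq_zero fun α => h α trivial, by
      rintro rfl α _
      exact ip_zero_right α⟩
  simp only [h1] at h
  simpa using h

open Classical in
theorem fourier_fourier (hχ : χ ≠ 1) (g : Amb F k → ℂ) (α : Amb F k) :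
    fourier χ (fourier χ g) α = Fintype.card (Amb F k) * g (-α) := by
  unfold fourier
  simp only [Finset.sum_mul]
  rw [Finset.sum_comm]
  have : ∀ δ β : Amb F k, g δ * χ (ip β δ) * χ (ip α β) = g δ * χ (ip β (δ + α)) := by
    intro δ β
    rw [ip_add_right, AddChar.map_add_eq_mul, ip_comm α β, mul_assoc]
  simp only [this, ← Finset.mul_sum, sum_char χ hχ]
  rw [Finset.sum_eq_single (-α)]
  · simp [mul_comm]
  · intro δ _ hδ
    rw [if_neg fun h => hδ (eq_neg_of_add_eq_zero_left h), mul_zero]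
  · simp

theorem fourier_injective (hχ : χ ≠ 1) {g : Amb F k → ℂ} (h : ∀ α, fourier χ g α = 0) :
    g = 0 := by
  classical
  funext α
  have h1 := fourier_fourier χ hχ g (-α)
  have h2 : fourier χ g = 0 := funext h
  rw [h2, neg_neg] at h1
  simp only [fourier, Pi.zero_apply, zero_mul, Finset.sum_const_zero] at h1
  exact (mul_eq_zero.1 h1.symm).resolve_left
    (Nat.cast_ne_zero.2 Fintype.card_ne_zero)

/-- A function constant on the classes of `Γ` is a linear combination of their indicators, whose
transforms are the character sums defining the dual partition. -/
theorem fourier_eq_of_dualPartition {Γ : Setoid (Amb F k)} {α γ : Amb F k}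
    (h : dualPartition χ Γ α γ) (g : Quotient Γ → ℂ) :
    fourier χ (fun β => g (Quotient.mk Γ β)) α = fourier χ (fun β => g (Quotient.mk Γ β)) γ := by
  classical
  have key : ∀ α : Amb F k, fourier χ (fun β => g (Quotient.mk Γ β)) α =
      ∑ q : Quotient Γ, g q * charSum χ {β | Quotient.mk Γ β = q} α := by
    intro α
    unfold fourier charSum
    rw [← Finset.sum_fiberwise (s := Finset.univ) (g := fun β => Quotient.mk Γ β)]
    refine Finset.sum_congr rfl fun q _ => ?_
    rw [Finset.mul_sum]
    refine Finset.sum_congr (by ext; simp) fun β hβ => ?_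
    simp only [Finset.mem_filter_univ] at hβ
    simp only [show Quotient.mk Γ β = q from hβ]
  rw [key, key]
  refine Finset.sum_congr rfl fun q _ => ?_
  rw [h]
  induction q using Quotient.inductionOn with
  | h y =>
    refine ⟨y, ?_⟩
    ext x
    exact Quotient.eq

open Classical in
/-- The Fourier transform, from functions on the classes of a partition to functions on the
classes of its dual. -/
noncomputable def fourierQuotient (Γ : Setoid (Amb F k)) :
    (Quotient Γ → ℂ) →ₗ[ℂ] (Quotient (dualPartition χ Γ) → ℂ) where
  toFun g q := fourier χ (fun β => g (Quotient.mk Γ β)) q.out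
  map_add' g h := by
    funext q
    simp [fourier, add_mul, Finset.sum_add_distrib]
  map_smul' c g := by
    funext q
    simp [fourier, mul_assoc, Finset.mul_sum]

theorem fourierQuotient_mk (Γ : Setoid (Amb F k)) (g : Quotient Γ → ℂ) (α : Amb F k) :
    fourierQuotient χ Γ g (Quotient.mk _ α) = fourier χ (fun β => g (Quotient.mk Γ β)) α :=
  fourier_eq_of_dualPartition χ (Quotient.mk_out (s := dualPartition χ Γ) α) g

theorem fourierQuotient_injective (hχ : χ ≠ 1) (Γ : Setoid (Amb F k)) :
    Function.Injective (fourierQuotient χ Γ) := by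
  rw [injective_iff_map_eq_zero]
  intro g hg
  have h1 := fourier_injective χ hχ (g := fun β => g (Quotient.mk Γ β)) fun α => by
    rw [← fourierQuotient_mk, hg]
    rfl
  funext q
  induction q using Quotient.inductionOn with
  | h y => exact congrFun h1 y

/-- The Fourier transform embeds functions on the classes of `Γ` into functions on the classes of
its dual; compare dimensions. -/
theorem card_quotient_le_dualPartition (hχ : χ ≠ 1) (Γ : Setoid (Amb F k)) :
    Nat.card (Quotient Γ) ≤ Nat.card (Quotient (dualPartition χ Γ)) := by
  classical
  have := LinearMap.finrank_le_finrank_of_injective (fourierQuotient_injective χ hχ Γ)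
  rwa [Module.finrank_fintype_fun_eq_card, Module.finrank_fintype_fun_eq_card,
    ← Nat.card_eq_fintype_card, ← Nat.card_eq_fintype_card] at this

/-- Equal counts make the Fourier map bijective, so each indicator of a dual class is the transform
of a function constant on classes of `Γ`. Transforming again returns that function at the negated
argument, so `Γ` refines its double dual; counting gives equality. -/
theorem fourierReflexive_of_card_eq (hχ : χ ≠ 1) {Γ : Setoid (Amb F k)}
    (hneg : ∀ x y, Γ x y → Γ (-x) (-y))
    (hc : Nat.card (Quotient (dualPartition χ Γ)) = Nat.card (Quotient Γ)) :
    FourierReflexive χ Γ := by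
  classical
  refine (setoid_eq_of_le_of_card ?_ (hc ▸ card_quotient_le_dualPartition χ hχ _)).symm
  intro x y hxy B hB
  obtain ⟨z, rfl⟩ := hB
  have hsurj := (LinearMap.injective_iff_surjective_of_finrank_eq_finrank (by
    rw [Module.finrank_fintype_fun_eq_card, Module.finrank_fintype_fun_eq_card,
      ← Nat.card_eq_fintype_card, ← Nat.card_eq_fintype_card, hc])).1
    (fourierQuotient_injective χ hχ Γ)
  obtain ⟨g, hg⟩ := hsurj fun q => if q = Quotient.mk _ z then 1 else 0
  have key : ∀ x, charSum χ {x | dualPartition χ Γ x z} x =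
      Fintype.card (Amb F k) * g (Quotient.mk Γ (-x)) := by
    intro x
    rw [← fourier_fourier χ hχ (fun β => g (Quotient.mk Γ β)), charSum_eq_fourier]
    congr 1
    funext β
    rw [← fourierQuotient_mk, hg]
    simp only [Quotient.eq, Set.mem_ofPred_eq]
  rw [key, key, Quotient.sound (hneg x y hxy)]

theorem card_eq_of_fourierReflexive (hχ : χ ≠ 1) {Γ : Setoid (Amb F k)}
    (h : FourierReflexive χ Γ) :
    Nat.card (Quotient (dualPartition χ Γ)) = Nat.card (Quotient Γ) := by
  refine le_antisymm ?_ (card_quotient_le_dualPartition χ hχ Γ)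
  have h1 := card_quotient_le_dualPartition χ hχ (dualPartition χ Γ)
  rwa [show dualPartition χ (dualPartition χ Γ) = Γ from h] at h1

open Classical in
/-- The Poisson summation formula for a code and a set of words. -/
theorem sum_charSum_submodule (hχ : χ ≠ 1) (C : Submodule F (Amb F k)) (B : Set (Amb F k)) :
    ∑ α ∈ Finset.univ.filter (fun α => α ∈ C), charSum χ B α =
      (Finset.univ.filter (fun α => α ∈ C)).card * ((dualCode C ∩ B).ncard : ℂ) := by
  unfold charSum
  rw [Finset.sum_comm]
  simp only [sum_char_submodule χ hχ]
  rw [← Finset.sum_filter, Finset.sum_const, Finset.filter_filter, nsmul_eq_mul, mul_comm]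
  congr 2
  rw [← Set.ncard_coe_finset]
  congr 1
  ext β
  simp [and_comm]

open Classical in
theorem sum_eq_of_sameDistribution {X : Type*} [Fintype X] {Δ : Setoid X} {D₁ D₂ : Set X}
    (h : SameDistribution Δ D₁ D₂) {g : X → ℂ} (hg : ∀ x y, Δ x y → g x = g y) :
    ∑ x ∈ Finset.univ.filter (fun x => x ∈ D₁), g x =
      ∑ x ∈ Finset.univ.filter (fun x => x ∈ D₂), g x := by
  have key : ∀ D : Set X, ∑ x ∈ Finset.univ.filter (fun x => x ∈ D), g x =
      ∑ q : Quotient Δ, ((D ∩ {x | Quotient.mk Δ x = q}).ncard : ℂ) * g q.out := by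
    intro D
    rw [← Finset.sum_fiberwise (g := fun β => Quotient.mk Δ β)]
    refine Finset.sum_congr rfl fun q _ => ?_
    rw [← nsmul_eq_mul, Finset.sum_congr rfl (g := fun _ => g q.out), Finset.sum_const]
    · congr 1
      rw [← Set.ncard_coe_finset]
      congr 1
      ext x
      simp
    · intro x hx
      refine hg _ _ (Quotient.exact ?_)
      rw [Quotient.out_eq]
      exact (Finset.mem_filter.1 hx).2
  rw [key, key]
  refine Finset.sum_congr rfl fun q _ => ?_
  congr 2
  refine h _ ?_
  induction q using Quotient.inductionOn with
  | h y =>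
    refine ⟨y, ?_⟩
    ext x
    exact Quotient.eq

/-- Character sums of classes of `Γ` are constant on classes of `Δ`, so their totals over the two
codes agree; Poisson summation turns these totals into intersection counts for the dual codes. -/
theorem sameDistribution_dualCode (hχ : χ ≠ 1) {Γ Δ : Setoid (Amb F k)}
    (h : Δ ≤ dualPartition χ Γ) {C₁ C₂ : Submodule F (Amb F k)}
    (hC : SameDistribution Δ (C₁ : Set (Amb F k)) (C₂ : Set (Amb F k))) :
    SameDistribution Γ (dualCode C₁) (dualCode C₂) := by
  classical
  intro B hB
  have h1 := sum_charSum_submodule χ hχ C₁ B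
  have h2 := sum_charSum_submodule χ hχ C₂ B
  have h3 := sum_eq_of_sameDistribution hC (g := charSum χ B) fun x y hxy => h hxy B hB
  -- The constant function `1` shows that the two codes have equal size.
  have h4 := sum_eq_of_sameDistribution hC (g := fun _ => 1) fun x y _ => rfl
  simp only [Finset.sum_const, nsmul_eq_mul, mul_one, SetLike.mem_coe] at h3 h4
  rw [h1, h2, h4] at h3
  have h5 : ((Finset.univ.filter (fun α => α ∈ C₂)).card : ℂ) ≠ 0 := by
    rw [Nat.cast_ne_zero, Finset.card_ne_zero]
    exact ⟨0, by simp⟩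
  exact_mod_cast mul_left_cancel₀ h5 h3

end Fourier

/-! ### MacWilliams identity, reflexivity and the dual weight partition -/

section MacWilliams

variable {Ω : Type u} [Fintype Ω] {F : Type v} [Field F] [Fintype F] {k : Ω → ℕ}
  {P : PartialOrder Ω} {ω : Ω → ℝ} (χ : AddChar F ℂ)

theorem mem_classes_weightPartition {H : Ω → Type w} [∀ i, AddCommGroup (H i)]
    {B : Set (∀ i, H i)} :
    B ∈ (weightPartition H P ω).classes ↔ ∃ y : ∀ i, H i, B = {x | wt P ω x = wt P ω y} :=
  Iff.rfl

/-- Lines through nonzero vectors of equal dual weight have equal distribution. Since weight classes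
are stable under nonzero scalars, Poisson summation on the line through `α` involves only the
character sums at `0` and at `α`, the latter `q - 1` times, and can be solved for it. -/
theorem le_dualPartition_of_macWilliams (hω : ∀ i, 0 < ω i) (hχ : χ ≠ 1)
    (h : AdmitsMacWilliamsIdentity F k P ω) :
    weightPartition (fun i => Fin (k i) → F) (dualPoset P) ω ≤
      dualPartition χ (weightPartition (fun i => Fin (k i) → F) P ω) := by
  classical
  intro α γ hαγ B hB
  have hαγ : wt (dualPoset P) ω α = wt (dualPoset P) ω γ := hαγ
  by_cases h0 : α = 0
  · subst h0
    rw [wt_zero] at hαγ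
    rw [eq_zero_of_wt_eq_zero (dualPoset P) hω hαγ.symm]
  have h0' : γ ≠ 0 := by
    rintro rfl
    rw [wt_zero] at hαγ
    exact h0 (eq_zero_of_wt_eq_zero (dualPoset P) hω hαγ)
  have hinj : ∀ {α : Amb F k}, α ≠ 0 → Function.Injective fun c : F => c • α := fun h0 =>
    smul_left_injective F h0
  have hfin : ∀ α : Amb F k, Finset.univ.filter (fun x => x ∈ Submodule.span F {α}) =
      Finset.univ.image fun c : F => c • α := by
    intro α
    ext x
    simp [Submodule.mem_span_singleton]
  have hd : SameDistribution (weightPartition (fun i => Fin (k i) → F) (dualPoset P) ω)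
      (Submodule.span F {α} : Set (Amb F k)) (Submodule.span F {γ} : Set (Amb F k)) := by
    intro B hB
    obtain ⟨y, rfl⟩ := mem_classes_weightPartition.1 hB
    have : ∀ {α : Amb F k}, α ≠ 0 → ((Submodule.span F {α} : Set (Amb F k)) ∩
        {x | wt (dualPoset P) ω x = wt (dualPoset P) ω y}).ncard =
        {c : F | wt (dualPoset P) ω (c • α) = wt (dualPoset P) ω y}.ncard := by
      intro α h0
      rw [← Set.ncard_image_of_injective _ (hinj h0)]
      congr 1
      ext x
      simp only [Set.mem_inter_iff, SetLike.mem_coe, Submodule.mem_span_singleton,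
        Set.mem_ofPred_eq, Set.mem_image]
      constructor
      · rintro ⟨⟨c, rfl⟩, hc⟩
        exact ⟨c, hc, rfl⟩
      · rintro ⟨c, hc, rfl⟩
        exact ⟨⟨c, rfl⟩, hc⟩
    rw [this h0, this h0']
    congr 1
    ext c
    simp only [Set.mem_ofPred_eq]
    by_cases hc : c = 0
    · simp [hc]
    · rw [wt_smul _ _ hc, wt_smul _ _ hc, hαγ]
  have hsum : ∀ {α : Amb F k}, α ≠ 0 →
      charSum χ B 0 + (Fintype.card F - 1 : ℂ) * charSum χ B α =
        Fintype.card F * ((dualCode (Submodule.span F {α}) ∩ B).ncard : ℂ) := by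
    intro α h0
    have h1 := sum_charSum_submodule χ hχ (Submodule.span F {α}) B
    rw [hfin, Finset.sum_image fun x _ y _ h => hinj h0 h,
      Finset.card_image_of_injective _ (hinj h0), Finset.card_univ,
      ← Finset.add_sum_erase _ _ (Finset.mem_univ (0 : F)), zero_smul] at h1
    rw [← h1]
    congr 1
    rw [Finset.sum_congr rfl (g := fun _ => charSum χ B α), Finset.sum_const,
      Finset.card_erase_of_mem (Finset.mem_univ _), Finset.card_univ, nsmul_eq_mul,
      Nat.cast_sub Fintype.card_pos, Nat.cast_one]
    intro c hc
    have hc0 : c ≠ 0 := (Finset.mem_erase.1 hc).1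
    obtain ⟨y, rfl⟩ := mem_classes_weightPartition.1 hB
    unfold charSum
    refine Finset.sum_equiv (LinearEquiv.smulOfNeZero F (Amb F k) c hc0).toEquiv ?_ ?_
    · intro β
      simp [wt_smul P ω hc0]
    · intro β _
      simp [ip_smul_left, ip_smul_right]
  have h1 := hsum h0
  have h2 := hsum h0'
  rw [h _ _ hd B hB, ← h2] at h1
  have h3 : (Fintype.card F - 1 : ℂ) ≠ 0 := by
    rw [sub_ne_zero]
    exact_mod_cast Fintype.one_lt_card.ne'
  exact mul_left_cancel₀ h3 (add_left_cancel h1)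

/-- The adjoint of an isometry of the dual poset is an isometry. -/
theorem exists_adjoint_isometry (hω : ∀ i, 0 < ω i) (hk : ∀ i, 0 < k i)
    {ψ : Amb F k ≃ₗ[F] Amb F k} (hψ : IsWeightIsometry F (dualPoset P) ω ψ) :
    ∃ T : Equiv.Perm (Amb F k), (∀ β, wt P ω (T β) = wt P ω β) ∧
      ∀ α β, ip (ψ α) β = ip α (T β) := by
  classical
  have : ∀ i, Nonempty (Fin (k i)) := fun i => ⟨⟨0, hk i⟩⟩
  obtain ⟨l, hlω, hl⟩ := hψ.exists_relIso hω
  let T : Amb F k → Amb F k := fun β i t => ip (ψ (Pi.single i (Pi.single t 1))) β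
  have hadj : ∀ α β, ip (ψ α) β = ip α (T β) := by
    intro α β
    have h1 : α = ∑ i, ∑ t, α i t • (Pi.single i (Pi.single t 1) : Amb F k) := by
      funext i t
      rw [← ip_single i t α, ← ip_single i t (∑ i, ∑ t, _), ip_single, ip_single]
      simp only [Finset.sum_apply, Pi.smul_apply, smul_eq_mul]
      rw [Finset.sum_eq_single i, Finset.sum_eq_single t]
      · simp
      · intro s _ hs
        simp [Pi.single_eq_of_ne hs.symm]
      · simp
      · intro j _ hj
        simp [Pi.single_eq_of_ne hj.symm]
      · simp
    let L : Amb F k →ₗ[F] F :=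
      { toFun := fun x => ip x β
        map_add' := fun x y => ip_add_left x y β
        map_smul' := fun c x => ip_smul_left c x β }
    have h2 : ip (ψ α) β = L (ψ α) := rfl
    rw [h2, h1]
    simp only [map_sum, map_smul]
    rw [← h1]
    rfl
  have hTinj : Function.Injective T := by
    intro β γ hβγ
    have : β + (-1 : F) • γ = 0 := eq_zero_of_ip_eq_zero fun α => by
      obtain ⟨α, rfl⟩ := ψ.surjective α
      rw [ip_add_right, ip_smul_right, hadj, hadj, hβγ]
      ring
    rw [neg_one_smul, ← sub_eq_add_neg, sub_eq_zero] at this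
    exact this
  have hle : ∀ β, wt P ω (T β) ≤ wt P ω β := by
    intro β
    -- If coordinate `i` of `T β` is nonzero, `β` meets the support of the image under `ψ` of a
    -- vector in block `i`, and that support lies above `l i` in `P`.
    have hsub : (idl P (T β)).map l.toEquiv.toEmbedding ⊆ idl P β := by
      intro x hx
      obtain ⟨j, hj, rfl⟩ := Finset.mem_map.1 hx
      obtain ⟨i, hi, hji⟩ := mem_idl.1 hj
      have hle : P.le (l j) (l i) := (relIsoOfDual l).map_rel_iff.2 hji
      refine mem_idl_of_le ?_ hle
      obtain ⟨t, ht⟩ := Function.ne_iff.1 hi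
      have ht : ip (ψ (Pi.single i (Pi.single t 1))) β ≠ 0 := ht
      obtain ⟨b, -, hb⟩ := Finset.exists_ne_zero_of_sum_ne_zero ht
      obtain ⟨s, -, hs⟩ := Finset.exists_ne_zero_of_sum_ne_zero hb
      have hb1 : ψ (Pi.single i (Pi.single t 1)) b ≠ 0 := fun h => hs (by simp [h])
      have hb2 : β b ≠ 0 := fun h => hs (by simp [h])
      obtain ⟨b, rfl⟩ := l.surjective b
      have h3 := (hl _ b).1 (mem_idl_self _ hb1)
      rw [(hasTop_single (by simp)).mem_idl_iff] at h3
      exact mem_idl.2 ⟨l b, hb2, (relIsoOfDual l).map_rel_iff.2 h3⟩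
    have := sum_le_sum_of_subset_pos hω hsub
    rw [Finset.sum_map] at this
    rw [wt_eq_sum_idl, wt_eq_sum_idl]
    refine le_trans (le_of_eq (Finset.sum_congr rfl fun i _ => ?_)) this
    exact (hlω i).symm
  let T' := Equiv.ofBijective T (Finite.injective_iff_bijective.1 hTinj)
  refine ⟨T', ?_, hadj⟩
  -- `T` permutes a finite set, so the weights before and after have the same total and each
  -- inequality is an equality.
  have := (Finset.sum_eq_sum_iff_of_le (fun β (_ : β ∈ Finset.univ) => hle β)).1
      (Equiv.sum_comp T' (fun β => wt P ω β))
  exact fun β => this β (Finset.mem_univ β)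

/-- An isometry of the dual poset carries `α` to `γ`; its adjoint permutes each weight class of `P`,
so reindexing identifies the two character sums. -/
theorem le_dualPartition_of_conditionD (hω : ∀ i, 0 < ω i) (hk : ∀ i, 0 < k i)
    (h : ConditionD F (fun i => Fin (k i) → F) P ω) :
    weightPartition (fun i => Fin (k i) → F) (dualPoset P) ω ≤
      dualPartition χ (weightPartition (fun i => Fin (k i) → F) P ω) := by
  classical
  intro α γ hαγ B hB
  obtain ⟨ψ, hψ, rfl⟩ := transitive_of_conditionD (dualPoset P) hω h.dual α γ hαγ
  obtain ⟨T, hT, hadj⟩ := exists_adjoint_isometry hω hk hψ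
  obtain ⟨y, rfl⟩ := mem_classes_weightPartition.1 hB
  unfold charSum
  symm
  refine Finset.sum_equiv T ?_ ?_
  · intro β
    simp [hT]
  · intro β _
    rw [hadj]

theorem eq_dualPartition_of_le (hk : ∀ i, 0 < k i) (hχ : χ ≠ 1)
    (h : weightPartition (fun i => Fin (k i) → F) (dualPoset P) ω ≤
      dualPartition χ (weightPartition (fun i => Fin (k i) → F) P ω)) :
    weightPartition (fun i => Fin (k i) → F) (dualPoset P) ω =
      dualPartition χ (weightPartition (fun i => Fin (k i) → F) P ω) := by
  have : ∀ i, Nonempty (Fin (k i)) := fun i => ⟨⟨0, hk i⟩⟩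
  refine setoid_eq_of_le_of_card h ?_
  rw [card_quotient_weightPartition_dual]
  exact card_quotient_le_dualPartition χ hχ _

theorem eq_dualPartition_iff_macWilliams (hω : ∀ i, 0 < ω i) (hk : ∀ i, 0 < k i) (hχ : χ ≠ 1) :
    weightPartition (fun i => Fin (k i) → F) (dualPoset P) ω =
      dualPartition χ (weightPartition (fun i => Fin (k i) → F) P ω) ↔
    AdmitsMacWilliamsIdentity F k P ω :=
  ⟨fun h _ _ hC => sameDistribution_dualCode χ hχ h.le hC, fun h =>
    eq_dualPartition_of_le χ hk hχ (le_dualPartition_of_macWilliams χ hω hχ h)⟩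

theorem fourierReflexive_of_eq_dualPartition (hk : ∀ i, 0 < k i) (hχ : χ ≠ 1)
    (h : weightPartition (fun i => Fin (k i) → F) (dualPoset P) ω =
      dualPartition χ (weightPartition (fun i => Fin (k i) → F) P ω)) :
    FourierReflexive χ (weightPartition (fun i => Fin (k i) → F) P ω) := by
  have : ∀ i, Nonempty (Fin (k i)) := fun i => ⟨⟨0, hk i⟩⟩
  refine fourierReflexive_of_card_eq χ hχ (fun x y hxy => ?_) ?_
  · have hxy : wt P ω x = wt P ω y := hxy
    change wt P ω (-x) = wt P ω (-y)
    rw [wt_neg, wt_neg, hxy]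
  · rw [← h, card_quotient_weightPartition_dual]

theorem eq_dualPartition_of_fourierReflexive (hk : ∀ i, 0 < k i) (hχ : χ ≠ 1)
    (h : FourierReflexive χ (weightPartition (fun i => Fin (k i) → F) P ω))
    (hle : dualPartition χ (weightPartition (fun i => Fin (k i) → F) P ω) ≤
      weightPartition (fun i => Fin (k i) → F) (dualPoset P) ω) :
    weightPartition (fun i => Fin (k i) → F) (dualPoset P) ω =
      dualPartition χ (weightPartition (fun i => Fin (k i) → F) P ω) := by
  have : ∀ i, Nonempty (Fin (k i)) := fun i => ⟨⟨0, hk i⟩⟩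
  refine (setoid_eq_of_le_of_card hle ?_).symm
  rw [card_quotient_weightPartition_dual, card_eq_of_fourierReflexive χ hχ h]

end MacWilliams

/-! ### Unique recovery of exponents and coefficients from products -/

section PolynomialIdentity

open Polynomial

/-- Take the root of argument `π / n`: its lower positive powers have argument strictly between `0`
and `π`. -/
theorem exists_pow_eq_neg {n : ℕ} (hn : 0 < n) {a : ℝ} (ha : 0 < a) :
    ∃ z : ℂ, z ^ n = -(a : ℂ) ∧ ∀ m, 0 < m → m < n → (z ^ m).im ≠ 0 := by
  have hn' : (0 : ℝ) < n := Nat.cast_pos.2 hn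
  let ρ : ℝ := a ^ ((n : ℝ)⁻¹)
  have hρ : 0 < ρ := Real.rpow_pos_of_pos ha _
  have hρn : ρ ^ n = a := Real.rpow_inv_natCast_pow ha.le hn.ne'
  have key : ∀ m : ℕ, ((ρ : ℂ) * Complex.exp ((Real.pi / n : ℝ) * Complex.I)) ^ m =
      ((ρ ^ m : ℝ) : ℂ) * Complex.exp ((m * (Real.pi / n) : ℝ) * Complex.I) := by
    intro m
    rw [mul_pow, ← Complex.exp_nat_mul]
    push_cast
    ring_nf
  refine ⟨(ρ : ℂ) * Complex.exp ((Real.pi / n : ℝ) * Complex.I), ?_, fun m hm hmn => ?_⟩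
  · rw [key, hρn, mul_div_cancel₀ _ hn'.ne', Complex.exp_pi_mul_I]
    ring
  · rw [key, Complex.im_ofReal_mul, Complex.exp_ofReal_mul_I_im]
    refine mul_ne_zero (pow_pos hρ m).ne' (Real.sin_pos_of_pos_of_lt_pi (by positivity) ?_).ne'
    rw [← mul_div_assoc, div_lt_iff₀ hn', mul_comm]
    exact mul_lt_mul_of_pos_left (Nat.cast_lt.2 hmn) Real.pi_pos

variable {ι : Type u} (n : ι → ℕ) (c : ι → ℝ)

/-- The product of the polynomials `1 - X ^ n i`. -/
noncomputable def numProd (A : Finset ι) : ℂ[X] := ∏ i ∈ A, (1 - X ^ n i)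

/-- The product of the polynomials `1 + c i X ^ n i`. -/
noncomputable def denProd (A : Finset ι) : ℂ[X] := ∏ i ∈ A, (1 + C (c i : ℂ) * X ^ n i)

variable {n c}

theorem one_sub_X_pow_ne_zero {m : ℕ} (hm : 0 < m) : (1 - X ^ m : ℂ[X]) ≠ 0 := by
  intro h
  have := congrArg (eval 0) h
  simp [hm.ne'] at this

theorem one_add_C_mul_X_pow_ne_zero {m : ℕ} (hm : 0 < m) (a : ℂ) :
    (1 + C a * X ^ m : ℂ[X]) ≠ 0 := by
  intro h
  have := congrArg (eval 0) h
  simp [hm.ne'] at this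

/-- Evaluate at a root of `1 + c i X ^ n i`, with `n i` maximal, whose lower powers are not real. No
factor of smaller exponent can vanish there, and `1 - X ^ n i` takes the value `1 + (c i)⁻¹`, so the
vanishing factor on the left comes from `B` and has the same exponent and coefficient. -/
theorem exists_match_of_prod_eq (hn : ∀ i, 0 < n i) (hc : ∀ i, 0 < c i) {A B : Finset ι}
    (h : numProd n A * denProd n c B = numProd n B * denProd n c A) {i : ι} (hi : i ∈ A)
    (hA : ∀ j ∈ A, n j ≤ n i) (hB : ∀ j ∈ B, n j ≤ n i) :
    ∃ j ∈ B, n i = n j ∧ c i = c j := by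
  obtain ⟨z, hz, him⟩ := exists_pow_eq_neg (hn i) (inv_pos.2 (hc i))
  have hci : (c i : ℂ) ≠ 0 := by exact_mod_cast (hc i).ne'
  have h1 := congrArg (eval z) h
  simp only [numProd, denProd, eval_mul, eval_prod, eval_sub, eval_add, eval_one, eval_pow,
    eval_X, eval_C] at h1
  have h2 : ∏ x ∈ A, (1 + (c x : ℂ) * z ^ n x) = 0 :=
    Finset.prod_eq_zero hi (by rw [hz]; push_cast; field_simp; ring)
  rw [h2, mul_zero, mul_eq_zero, Finset.prod_eq_zero_iff, Finset.prod_eq_zero_iff] at h1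
  rcases h1 with ⟨j, hj, h0⟩ | ⟨j, hj, h0⟩
  · exfalso
    rcases (hA j hj).lt_or_eq with hlt | heq
    · apply him (n j) (hn j) hlt
      rw [sub_eq_zero] at h0
      rw [← h0]
      simp
    · rw [heq, hz, sub_neg_eq_add] at h0
      have h2 : (1 + (c i)⁻¹ : ℝ) = 0 := by exact_mod_cast h0
      linarith [inv_pos.2 (hc i)]
  · rcases (hB j hj).lt_or_eq with hlt | heq
    · exfalso
      apply him (n j) (hn j) hlt
      have h2 := congrArg Complex.im h0
      rw [Complex.add_im, Complex.one_im, zero_add, Complex.im_ofReal_mul, Complex.zero_im] at h2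
      exact (mul_eq_zero.1 h2).resolve_left (hc j).ne'
    · refine ⟨j, hj, heq.symm, ?_⟩
      rw [heq, hz] at h0
      have h2 : (1 + c j * -(c i)⁻¹ : ℝ) = 0 := by exact_mod_cast h0
      have := (hc i).ne'
      field_simp at h2
      linarith

open Classical in
theorem prod_eq_erase (hn : ∀ i, 0 < n i) {A B : Finset ι}
    (h : numProd n A * denProd n c B = numProd n B * denProd n c A) {i j : ι} (hi : i ∈ A)
    (hj : j ∈ B) (hij : n i = n j) (hij' : c i = c j) :
    numProd n (A.erase i) * denProd n c (B.erase j) =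
      numProd n (B.erase j) * denProd n c (A.erase i) := by
  unfold numProd denProd at h ⊢
  rw [← Finset.mul_prod_erase A _ hi, ← Finset.mul_prod_erase B _ hj,
    ← Finset.mul_prod_erase A _ hi, ← Finset.mul_prod_erase B _ hj, hij, hij'] at h
  refine mul_left_cancel₀ (mul_ne_zero (one_sub_X_pow_ne_zero (hn j))
    (one_add_C_mul_X_pow_ne_zero (hn j) (c j : ℂ))) ?_
  linear_combination h

open Classical in
/-- The products of the rational functions `(1 - X ^ n) / (1 + c X ^ n)` determine the
multiplicities of the pairs `(n, c)`. -/
theorem label_card_eq_of_prod_eq {L : Type v} (d : ι → L) (p : ι → Prop) (hn : ∀ i, 0 < n i)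
    (hc : ∀ i, 0 < c i) (hd : ∀ i j, p i → p j → n i = n j → c i = c j → d i = d j)
    {A B : Finset ι} (hA : ∀ i ∈ A, p i) (hB : ∀ i ∈ B, p i)
    (h : numProd n A * denProd n c B = numProd n B * denProd n c A) (l : L) :
    (A.filter (fun i => d i = l)).card = (B.filter (fun i => d i = l)).card := by
  refine label_card_eq_of_cancel d d (fun A B => (∀ i ∈ A, p i) ∧ (∀ i ∈ B, p i) ∧
    numProd n A * denProd n c B = numProd n B * denProd n c A) ?_ A B ⟨hA, hB, h⟩ l
  clear h hA hB A B
  rintro A B ⟨hA, hB, h⟩ hne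
  obtain ⟨i, hi, hmax⟩ := Finset.exists_max_image (A ∪ B) n (by
    rcases hne with h | h
    · exact h.mono Finset.subset_union_left
    · exact h.mono Finset.subset_union_right)
  have hmA : ∀ j ∈ A, n j ≤ n i := fun j hj => hmax j (Finset.mem_union_left _ hj)
  have hmB : ∀ j ∈ B, n j ≤ n i := fun j hj => hmax j (Finset.mem_union_right _ hj)
  have : ∃ i ∈ A, ∃ j ∈ B, n i = n j ∧ c i = c j := by
    rcases Finset.mem_union.1 hi with hi | hi
    · exact ⟨i, hi, exists_match_of_prod_eq hn hc h hi hmA hmB⟩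
    · obtain ⟨j, hj, h1, h2⟩ := exists_match_of_prod_eq hn hc h.symm hi hmB hmA
      exact ⟨j, hj, i, hi, h1.symm, h2.symm⟩
  obtain ⟨i, hi, j, hj, h1, h2⟩ := this
  exact ⟨i, hi, j, hj, hd i j (hA i hi) (hB j hj) h1 h2,
    fun x hx => hA x (Finset.mem_of_mem_erase hx), fun x hx => hB x (Finset.mem_of_mem_erase hx),
    prod_eq_erase hn h hi hj h1 h2⟩

open Classical in
-- Both sides are the full denominator over `W` times a ratio of the two products over `A` or `B`;
-- cross-multiplying and cancelling that denominator leaves the polynomial identity.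
theorem prod_eq_of_prod_ite_eq (hn : ∀ i, 0 < n i) {W A B : Finset ι} (hA : A ⊆ W) (hB : B ⊆ W)
    (h : ∀ z : ℂ, ∏ i ∈ W, (if i ∈ A then 1 - z ^ n i else 1 + c i * z ^ n i) =
      ∏ i ∈ W, (if i ∈ B then 1 - z ^ n i else 1 + c i * z ^ n i)) :
    numProd n A * denProd n c B = numProd n B * denProd n c A := by
  have hE : ∀ A ⊆ W, denProd n c W * numProd n A =
      (∏ i ∈ W, (if i ∈ A then 1 - X ^ n i else 1 + C (c i : ℂ) * X ^ n i)) * denProd n c A := by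
    intro A hA
    have hW : ∀ f : ι → ℂ[X], ∏ i ∈ A, f i = ∏ i ∈ W, if i ∈ A then f i else 1 := fun f => by
      rw [Finset.prod_ite_mem, Finset.inter_eq_right.2 hA]
    unfold denProd numProd
    rw [hW, hW, ← Finset.prod_mul_distrib, ← Finset.prod_mul_distrib]
    refine Finset.prod_congr rfl fun i hi => ?_
    by_cases h : i ∈ A
    · simp only [h, if_true]
      ring
    · simp only [h, if_false]
  have h1 : (∏ i ∈ W, (if i ∈ A then 1 - X ^ n i else 1 + C (c i : ℂ) * X ^ n i) : ℂ[X]) =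
      ∏ i ∈ W, (if i ∈ B then 1 - X ^ n i else 1 + C (c i : ℂ) * X ^ n i) := by
    refine Polynomial.funext fun z => ?_
    rw [eval_prod, eval_prod]
    convert h z using 2 with i _ i _
    · split_ifs <;> simp
    · split_ifs <;> simp
  have h2 : denProd n c W ≠ 0 :=
    Finset.prod_ne_zero_iff.2 fun i _ => one_add_C_mul_X_pow_ne_zero (hn i) _
  refine mul_left_cancel₀ h2 ?_
  rw [← mul_assoc, ← mul_assoc, hE A hA, hE B hB, h1]
  ring

end PolynomialIdentity

/-! ### Level enumerators for hierarchical posets with integer weights -/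

section GeneratingFunction

variable {Ω : Type u} [Fintype Ω] {F : Type v} [Field F] [Fintype F] {k : Ω → ℕ}
  {P : PartialOrder Ω} {ω : Ω → ℝ} (χ : AddChar F ℂ)

theorem addChar_map_sum {ι : Type*} (s : Finset ι) (f : ι → F) :
    χ (∑ i ∈ s, f i) = ∏ i ∈ s, χ (f i) := by
  classical
  induction s using Finset.induction_on with
  | empty => simp
  | insert i s hi ih =>
    rw [Finset.sum_insert hi, Finset.prod_insert hi, AddChar.map_add_eq_mul, ih]

open Classical in
theorem sum_char_block (hχ : χ ≠ 1) {m : ℕ} (a : Fin m → F) :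
    ∑ x : Fin m → F, χ (∑ t, a t * x t) =
      if a = 0 then (Fintype.card F : ℂ) ^ m else 0 := by
  have h := sum_char (k := fun _ : Unit => m) χ hχ (fun _ => a)
  have h1 : (fun _ : Unit => a) = 0 ↔ a = 0 := by
    constructor
    · exact fun h => congrFun h ()
    · rintro rfl
      rfl
  rw [← (Equiv.funUnique Unit (Fin m → F)).sum_comp]
  simp only [h1] at h
  have hcard : ∀ I : Fintype (Amb F fun _ : Unit => m), @Fintype.card _ I = Fintype.card F ^ m := by
    intro I
    rw [← @Nat.card_eq_fintype_card _ I]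
    rw [Nat.card_pi]
    simp
  rw [hcard] at h
  push_cast at h
  rw [← h]
  refine Finset.sum_congr (by ext; simp) fun x _ => ?_
  simp [ip, mul_comm]

open Classical in
/-- A function of the weight which is multiplicative over blocks when the poset is
hierarchical. -/
noncomputable def levelEnum (P : PartialOrder Ω) (ω : Ω → ℝ) (r : ℕ) (z : ℂ) (x : ℝ) : ℂ :=
  if x ≤ ∑ i ∈ Finset.univ.filter (fun i => len P i ≤ r), ω i then
    z ^ ⌊x - ∑ i ∈ Finset.univ.filter (fun i => len P i < r), ω i⌋₊ else 0

open Classical in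
-- In a hierarchical poset, a vector that is nonzero in level `r` and zero above it has weight equal
-- to that of all lower levels plus that of its support in level `r`. The bound in `levelEnum`
-- discards exactly the vectors reaching above level `r`.
theorem levelEnum_wt (hP : IsHierarchical P) {n : Ω → ℕ} (hn : ∀ i, 0 < n i)
    (hω : ∀ i, ω i = n i) {H : Ω → Type w} [∀ i, AddCommGroup (H i)] (r : ℕ) (z : ℂ)
    (β : ∀ i, H i) : levelEnum P ω r z (wt P ω β) =
      ∏ i, (if β i = 0 ∨ len P i < r then 1 else if len P i = r then z ^ n i else 0) := by
  have hpos : ∀ i, 0 < ω i := fun i => by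
    rw [hω]
    exact Nat.cast_pos.2 (hn i)
  unfold levelEnum
  by_cases h1 : ∃ b, β b ≠ 0 ∧ r < len P b
  · obtain ⟨b, hb, hrb⟩ := h1
    rw [if_neg, Finset.prod_eq_zero (Finset.mem_univ b)]
    · rw [if_neg (by simp [hb]; omega), if_neg (by omega)]
    · rw [not_le, wt_eq_sum_idl]
      refine Finset.sum_lt_sum_of_subset (i := b) ?_ (mem_idl_self P hb) (by simp [hrb]) (hpos b)
        fun i _ _ => (hpos i).le
      intro i hi
      simp only [Finset.mem_filter_univ] at hi
      exact mem_idl.2 ⟨b, hb, hP.le_iff.2 (Or.inr (by omega))⟩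
  · push Not at h1
    have hprod : ∏ i, (if β i = 0 ∨ len P i < r then 1 else if len P i = r then z ^ n i else 0) =
        z ^ ∑ i ∈ Finset.univ.filter (fun i => β i ≠ 0 ∧ len P i = r), n i := by
      rw [← Finset.prod_pow_eq_pow_sum, Finset.prod_filter]
      refine Finset.prod_congr rfl fun i _ => ?_
      by_cases h2 : β i = 0
      · simp [h2]
      · have := h1 i h2
        rcases this.lt_or_eq with h3 | h3
        · simp [h3, h3.ne]
        · simp [h2, h3]
    have hsub : idl P β ⊆ Finset.univ.filter (fun i => len P i ≤ r) := by
      intro i hi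
      obtain ⟨b, hb, hib⟩ := mem_idl.1 hi
      simp only [Finset.mem_filter_univ]
      exact (len_le_len P hib).trans (h1 b hb)
    rw [hprod, if_pos (show wt P ω β ≤ _ from sum_le_sum_of_subset_pos hpos hsub)]
    congr 1
    by_cases h2 : ∃ b, β b ≠ 0 ∧ len P b = r
    · obtain ⟨b, hb, hbr⟩ := h2
      have h3 : idl P β = Finset.univ.filter (fun i => len P i < r) ∪
          Finset.univ.filter (fun i => β i ≠ 0 ∧ len P i = r) := by
        ext i
        simp only [Finset.mem_union, Finset.mem_filter_univ]
        constructor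
        · intro hi
          obtain ⟨c, hc, hic⟩ := mem_idl.1 hi
          have h4 := h1 c hc
          rcases hP.le_iff.1 hic with rfl | h5
          · rcases h4.lt_or_eq with h4 | h4
            · exact Or.inl h4
            · exact Or.inr ⟨hc, h4⟩
          · exact Or.inl (by omega)
        · rintro (h | h)
          · exact mem_idl.2 ⟨b, hb, hP.le_iff.2 (Or.inr (by omega))⟩
          · exact mem_idl_self P h.1
      have h4 : wt P ω β = ∑ i ∈ Finset.univ.filter (fun i => len P i < r), ω i +
          ((∑ i ∈ Finset.univ.filter (fun i => β i ≠ 0 ∧ len P i = r), n i : ℕ) : ℝ) := by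
        rw [wt_eq_sum_idl, h3, Finset.sum_union]
        · push_cast
          simp only [hω]
        · rw [Finset.disjoint_filter]
          intro i _ h h'
          omega
      rw [h4, add_sub_cancel_left, Nat.floor_natCast]
    · push Not at h2
      -- With no nonzero block in level `r` the difference is nonpositive, so its natural floor is
      -- `0`, matching the empty exponent.
      rw [Finset.sum_eq_zero (s := Finset.univ.filter (fun i => β i ≠ 0 ∧ len P i = r))]
      · refine Nat.floor_of_nonpos (sub_nonpos.2 (sum_le_sum_of_subset_pos hpos ?_))
        intro i hi
        obtain ⟨b, hb, hib⟩ := mem_idl.1 hi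
        simp only [Finset.mem_filter_univ]
        exact (len_le_len P hib).trans_lt (lt_of_le_of_ne (h1 b hb) (h2 b hb))
      · intro i hi
        simp only [Finset.mem_filter_univ] at hi
        exact absurd hi.2 (h2 i hi.1)

open Classical in
-- The transform factors over blocks. Below level `r` the character is trivial and each block
-- contributes its size; above, only the zero block survives; in level `r`, the block sum depends
-- only on whether `α i` vanishes.
theorem fourier_levelEnum (hχ : χ ≠ 1) (hP : IsHierarchical P) {n : Ω → ℕ} (hn : ∀ i, 0 < n i)
    (hω : ∀ i, ω i = n i) (r : ℕ) (z : ℂ) {α : Amb F k} (hα : ∀ i, len P i < r → α i = 0) :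
    fourier χ (fun β => levelEnum P ω r z (wt P ω β)) α =
      (∏ i ∈ Finset.univ.filter (fun i => len P i < r), (Fintype.card F : ℂ) ^ k i) *
      ∏ i ∈ Finset.univ.filter (fun i => len P i = r),
        (if i ∈ Finset.univ.filter (fun i => len P i = r ∧ α i ≠ 0) then 1 - z ^ n i
          else 1 + ((Fintype.card F : ℝ) ^ k i - 1 : ℝ) * z ^ n i) := by
  have h1 : fourier χ (fun β => levelEnum P ω r z (wt P ω β)) α =
      ∏ i, ∑ x : Fin (k i) → F,
        (if x = 0 ∨ len P i < r then 1 else if len P i = r then z ^ n i else 0) *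
          χ (∑ t, α i t * x t) := by
    rw [Finset.prod_univ_sum, Fintype.piFinset_univ]
    unfold fourier
    refine Finset.sum_congr rfl fun β _ => ?_
    change levelEnum P ω r z (wt P ω β) * _ = _
    rw [levelEnum_wt hP hn hω, ip, addChar_map_sum, ← Finset.prod_mul_distrib]
    exact Finset.prod_congr rfl fun i _ => by congr
  rw [h1, Finset.prod_filter, Finset.prod_filter, ← Finset.prod_mul_distrib]
  refine Finset.prod_congr rfl fun i _ => ?_
  rcases lt_trichotomy (len P i) r with h | h | h
  · simp [h, h.ne, hα i h]
  · have h2 : ∀ x : Fin (k i) → F,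
        (if x = 0 ∨ len P i < r then 1 else if len P i = r then z ^ n i else 0) *
          χ (∑ t, α i t * x t) = z ^ n i * χ (∑ t, α i t * x t) +
            if x = 0 then 1 - z ^ n i else 0 := by
      intro x
      by_cases hx : x = 0
      · simp [hx]
      · simp [hx, h]
    simp only [h2]
    rw [Finset.sum_add_distrib, ← Finset.mul_sum, sum_char_block χ hχ]
    by_cases h0 : α i = 0
    · simp [h0, h]
      ring
    · simp [h0, h]
  · have h2 : ∀ x : Fin (k i) → F,
        (if x = 0 ∨ len P i < r then 1 else if len P i = r then z ^ n i else 0) *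
          χ (∑ t, α i t * x t) = if x = 0 then 1 else 0 := by
      intro x
      by_cases hx : x = 0
      · simp [hx]
      · simp [hx, h.not_gt, h.ne']
    simp only [h2]
    simp [h.ne', h.not_gt]

/-- The level enumerators are functions of the weight, so their transforms agree at `α` and `γ` for
every `z`. The resulting identity of products matches the two supports in level `r` by weight and
dimension. -/
theorem exists_perm_level_of_dualPartition (hχ : χ ≠ 1) (hP : IsHierarchical P) {n : Ω → ℕ}
    (hn : ∀ i, 0 < n i) (hω : ∀ i, ω i = n i) (hk : ∀ i, 0 < k i) (r : ℕ) {α γ : Amb F k}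
    (h : dualPartition χ (weightPartition (fun i => Fin (k i) → F) P ω) α γ)
    (hα : ∀ i, len P i < r → α i = 0) (hγ : ∀ i, len P i < r → γ i = 0) :
    ∃ σ : Equiv.Perm Ω, (∀ i, len P (σ i) = len P i) ∧ (∀ i, ω (σ i) = ω i) ∧
      (∀ i, k (σ i) = k i) ∧ ∀ i, len P i = r → (γ (σ i) ≠ 0 ↔ α i ≠ 0) := by
  classical
  have hq : 1 < Fintype.card F := Fintype.one_lt_card
  have hq' : (Fintype.card F : ℂ) ≠ 0 := by simp
  have h1 := fun z : ℂ => fourier_eq_of_dualPartition χ h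
    (fun q => levelEnum P ω r z (Setoid.kerLift (wt P ω) q))
  have h2 : ∀ z : ℂ, fourier χ (fun β => levelEnum P ω r z (wt P ω β)) α =
      fourier χ (fun β => levelEnum P ω r z (wt P ω β)) γ := h1
  simp only [fourier_levelEnum χ hχ hP hn hω r _ hα, fourier_levelEnum χ hχ hP hn hω r _ hγ] at h2
  have h3 := prod_eq_of_prod_ite_eq (c := fun i => (Fintype.card F : ℝ) ^ k i - 1) hn
    (fun i hi => by simp at hi ⊢; exact hi.1) (fun i hi => by simp at hi ⊢; exact hi.1)
    fun z => mul_left_cancel₀ (Finset.prod_ne_zero_iff.2 fun i _ => pow_ne_zero _ hq') (h2 z)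
  have hc : ∀ i, 0 < (Fintype.card F : ℝ) ^ k i - 1 := fun i =>
    sub_pos.2 (one_lt_pow₀ (by exact_mod_cast hq) (hk i).ne')
  -- Within level `r` the pair `(n i, q ^ k i - 1)` determines the whole label, because `q ^ k`
  -- determines `k`.
  obtain ⟨σ, hσ, hσ'⟩ := exists_perm_of_label_card_eq (fun i => (len P i, n i, k i)) _ _
    (label_card_eq_of_prod_eq (fun i => (len P i, n i, k i)) (fun i => len P i = r) hn hc
      (fun i j hi hj hij hij' => by
        have : k i = k j := Nat.pow_right_injective hq (by exact_mod_cast sub_left_injective hij')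
        simp [hi, hj, hij, this]) (fun i hi => by simp at hi; exact hi.1)
        (fun i hi => by simp at hi; exact hi.1) h3)
  simp only [Prod.mk.injEq] at hσ
  refine ⟨σ, fun i => (hσ i).1, fun i => by rw [hω, hω, (hσ i).2.1], fun i => (hσ i).2.2,
    fun i hi => ?_⟩
  have := hσ' i
  simpa [(hσ i).1, hi] using this

theorem eq_zero_below_of_dualPartition (hχ : χ ≠ 1) (hP : IsHierarchical P) {n : Ω → ℕ}
    (hn : ∀ i, 0 < n i) (hω : ∀ i, ω i = n i) (hk : ∀ i, 0 < k i) {α γ : Amb F k}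
    (h : dualPartition χ (weightPartition (fun i => Fin (k i) → F) P ω) α γ) (r : ℕ)
    (hα : ∀ i, len P i < r → α i = 0) : ∀ i, len P i < r → γ i = 0 := by
  induction r with
  | zero => simp
  | succ r ih =>
    have hα' : ∀ i, len P i < r → α i = 0 := fun i hi => hα i (by omega)
    have hγ' := ih hα'
    intro i hi
    rcases Nat.lt_succ_iff_lt_or_eq.1 hi with hi | hi
    · exact hγ' i hi
    · obtain ⟨σ, hσ, -, -, hσ'⟩ :=
        exists_perm_level_of_dualPartition χ hχ hP hn hω hk r h hα' hγ'
      obtain ⟨i, rfl⟩ := σ.surjective i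
      rw [hσ] at hi
      by_contra h0
      exact (hσ' i hi).1 h0 (hα i (by omega))

/-- For hierarchical posets and integer weights, vectors in the same class of the dual partition
have ideals in the dual poset that are related by an automorphism. -/
theorem exists_perm_of_dualPartition (hχ : χ ≠ 1) (hP : IsHierarchical P) {n : Ω → ℕ}
    (hn : ∀ i, 0 < n i) (hω : ∀ i, ω i = n i) (hk : ∀ i, 0 < k i) {α γ : Amb F k}
    (h : dualPartition χ (weightPartition (fun i => Fin (k i) → F) P ω) α γ) :
    ∃ σ : Equiv.Perm Ω, (∀ i, len P (σ i) = len P i) ∧ (∀ i, ω (σ i) = ω i) ∧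
      (∀ i, k (σ i) = k i) ∧ ∀ i, i ∈ idl (dualPoset P) α ↔ σ i ∈ idl (dualPoset P) γ := by
  classical
  by_cases h0 : α = 0
  · subst h0
    have : γ = 0 := by
      funext i
      exact eq_zero_below_of_dualPartition χ hχ hP hn hω hk h (len P i + 1) (fun _ _ => rfl) i
        (Nat.lt_succ_self _)
    subst this
    exact ⟨Equiv.refl _, fun _ => rfl, fun _ => rfl, fun _ => rfl, fun _ => Iff.rfl⟩
  -- The dual ideal of `α` consists of its support in the lowest level it meets, together with all
  -- higher levels; matching that one level therefore suffices.
  · obtain ⟨b, hb, hmin⟩ := Finset.exists_min_image (Finset.univ.filter fun i => α i ≠ 0) (len P)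
      (by
        obtain ⟨i, hi⟩ := Function.ne_iff.1 h0
        exact ⟨i, by simpa using hi⟩)
    simp only [Finset.mem_filter_univ] at hb hmin
    have hα : ∀ i, len P i < len P b → α i = 0 := fun i hi => by
      by_contra h1
      exact absurd (hmin i h1) (not_le.2 hi)
    have hγ := eq_zero_below_of_dualPartition χ hχ hP hn hω hk h _ hα
    obtain ⟨σ, hσ, hσω, hσk, hσ'⟩ :=
      exists_perm_level_of_dualPartition χ hχ hP hn hω hk _ h hα hγ
    have key : ∀ {β : Amb F k} {b : Ω}, β b ≠ 0 → (∀ i, len P i < len P b → β i = 0) → ∀ i,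
        i ∈ idl (dualPoset P) β ↔ (len P i = len P b ∧ β i ≠ 0) ∨ len P b < len P i := by
      intro β b hb hβ i
      constructor
      · intro hi
        obtain ⟨c, hc, hci⟩ := mem_idl.1 hi
        have hc' : len P b ≤ len P c := by
          by_contra hlt
          exact hc (hβ c (not_le.1 hlt))
        have hci : P.le c i := hci
        rcases hP.le_iff.1 hci with rfl | h1
        · rcases hc'.lt_or_eq with h2 | h2
          · exact Or.inr h2
          · exact Or.inl ⟨h2.symm, hc⟩
        · exact Or.inr (by omega)
      · rintro (h1 | h1)
        · exact mem_idl_self _ h1.2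
        · exact mem_idl.2 ⟨b, hb, hP.le_iff.2 (Or.inr h1)⟩
    refine ⟨σ, hσ, hσω, hσk, fun i => ?_⟩
    rw [key hb hα, key ((hσ' b rfl).2 hb) (by rwa [hσ]), hσ, hσ]
    constructor
    · rintro (h1 | h1)
      · exact Or.inl ⟨h1.1, (hσ' i h1.1).2 h1.2⟩
      · exact Or.inr h1
    · rintro (h1 | h1)
      · exact Or.inl ⟨h1.1, (hσ' i h1.1).1 h1.2⟩
      · exact Or.inr h1

theorem dualPartition_le_of_hierarchical (hχ : χ ≠ 1) (hP : IsHierarchical P) {n : Ω → ℕ}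
    (hn : ∀ i, 0 < n i) (hω : ∀ i, ω i = n i) (hk : ∀ i, 0 < k i) :
    dualPartition χ (weightPartition (fun i => Fin (k i) → F) P ω) ≤
      weightPartition (fun i => Fin (k i) → F) (dualPoset P) ω := by
  intro α γ h
  obtain ⟨σ, -, hσω, -, hσ⟩ := exists_perm_of_dualPartition χ hχ hP hn hω hk h
  exact wt_eq_of_perm (dualPoset P) σ hσω hσ

/-- Dual ideals of equal weight come from vectors in one class of the dual partition, hence
correspond under a permutation preserving length, weight and dimension. Hierarchy makes it an
automorphism, and complements return the statement to `P`. -/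
theorem conditionD_of_hierarchical (hχ : χ ≠ 1) (hP : IsHierarchical P) {n : Ω → ℕ}
    (hn : ∀ i, 0 < n i) (hω : ∀ i, ω i = n i) (hk : ∀ i, 0 < k i)
    (h : weightPartition (fun i => Fin (k i) → F) (dualPoset P) ω ≤
      dualPartition χ (weightPartition (fun i => Fin (k i) → F) P ω)) :
    ConditionD F (fun i => Fin (k i) → F) P ω := by
  classical
  have : ∀ i, Nonempty (Fin (k i)) := fun i => ⟨⟨0, hk i⟩⟩
  have key : ∀ I J : Finset Ω, IsIdeal (dualPoset P) (I : Set Ω) →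
      IsIdeal (dualPoset P) (J : Set Ω) → ∑ i ∈ I, ω i = ∑ j ∈ J, ω j →
      ∃ σ : Equiv.Perm Ω, (∀ i, len P (σ i) = len P i) ∧ (∀ i, ω (σ i) = ω i) ∧
        (∀ i, k (σ i) = k i) ∧ ∀ i, i ∈ I ↔ σ i ∈ J := by
    intro I J hI hJ hIJ
    obtain ⟨α, -, rfl⟩ := exists_idl_eq (H := fun i => Fin (k i) → F) (dualPoset P) hI
    obtain ⟨γ, -, rfl⟩ := exists_idl_eq (H := fun i => Fin (k i) → F) (dualPoset P) hJ
    exact exists_perm_of_dualPartition χ hχ hP hn hω hk (h (show Setoid.ker _ α γ from hIJ))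
  refine ⟨UDP.dual (P := dualPoset P) fun I J hI hJ hIJ => ?_, fun u v huv hω' => ?_⟩
  · obtain ⟨σ, hσ, hσω, -, hσ'⟩ := key I J hI hJ hIJ
    refine ⟨relIsoDual (hP.relIsoOfLen P σ hσ), ?_, hσω⟩
    ext j
    constructor
    · intro hj
      exact ⟨σ.symm j, (hσ' _).2 (by simpa using hj), σ.apply_symm_apply j⟩
    · rintro ⟨i, hi, rfl⟩
      exact (hσ' i).1 hi
  -- Adding a single element `u` to all longer ones gives a dual ideal in which `u` is the only
  -- element of its length, so the matching must send `u` to `v`.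
  · have hI : ∀ u, IsIdeal (dualPoset P)
        ((insert u (Finset.univ.filter fun j => len P u < len P j) : Finset Ω) : Set Ω) := by
      intro u b hb a hab
      have hab : P.le b a := hab
      simp only [Finset.coe_insert, Finset.coe_filter_univ, Set.mem_insert_iff,
        Set.mem_ofPred_eq] at hb ⊢
      by_cases e : b = a
      · exact e ▸ hb
      · have := len_lt_len P hab e
        rcases hb with rfl | hb
        · exact Or.inr this
        · exact Or.inr (hb.trans this)
    obtain ⟨σ, hσ, -, hσk, hσ'⟩ := key _ _ (hI u) (hI v) (by simp [huv, hω'])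
    have h1 := (hσ' u).1 (by simp)
    simp only [Finset.mem_insert, Finset.mem_filter_univ, hσ, huv, lt_irrefl, or_false] at h1
    have h2 := hσk u
    rw [h1] at h2
    change Nonempty ((Fin (k u) → F) ≃ₗ[F] (Fin (k v) → F))
    rw [h2]
    exact ⟨LinearEquiv.refl F _⟩

end GeneratingFunction

/-! ### Families of subspaces determined by their indicator sums -/

section Subspaces

variable {F : Type v} [Field F] [Fintype F] {E : Type w} [AddCommGroup E] [Module F E] [Finite E]

theorem natCard_mul_card_le_of_lt {A B : Submodule F E} (h : A < B) :
    Nat.card A * Fintype.card F ≤ Nat.card B := by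
  have := Module.natCard_eq_pow_finrank (K := F) (V := A)
  have hB := Module.natCard_eq_pow_finrank (K := F) (V := B)
  rw [Nat.card_eq_fintype_card (α := F)] at this hB
  rw [this, hB, ← pow_succ]
  exact Nat.pow_le_pow_right Fintype.card_pos (Submodule.finrank_lt_finrank_of_lt h)

open Classical in
theorem sum_indicator_eq_sum_natCard {ι : Type u} [Fintype E] (K : Submodule F E)
    (T : Finset ι) (U : ι → Submodule F E) :
    ∑ x ∈ Finset.univ.filter (fun x => x ∈ K), ∑ j ∈ T, (if x ∈ U j then 1 else 0) =
      ∑ j ∈ T, Nat.card (K ⊓ U j : Submodule F E) := by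
  rw [Finset.sum_comm]
  refine Finset.sum_congr rfl fun j _ => ?_
  rw [← Finset.sum_filter, Finset.filter_filter, Finset.sum_const, smul_eq_mul, mul_one,
    ← Set.ncard_coe_finset]
  simp only [Finset.coe_filter_univ]
  rfl

open Classical in
/-- A subspace is not covered by at most `|F|` subspaces that do not contain it. -/
theorem exists_le_of_covered {ι : Type u} {K : Submodule F E} {T : Finset ι}
    {U : ι → Submodule F E} (hT : T.card ≤ Fintype.card F)
    (h : ∀ x ∈ K, ∃ j ∈ T, x ∈ U j) : ∃ j ∈ T, K ≤ U j := by
  have : Fintype E := Fintype.ofFinite E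
  by_contra hno
  push Not at hno
  have hq : 1 < Fintype.card F := Fintype.one_lt_card
  have hlt : ∀ j ∈ T, Nat.card (K ⊓ U j : Submodule F E) * Fintype.card F ≤ Nat.card K :=
    fun j hj => natCard_mul_card_le_of_lt (lt_of_le_of_ne inf_le_left fun e =>
      hno j hj (inf_eq_left.1 e))
  have h1 := sum_indicator_eq_sum_natCard K T U
  have h0 : (0 : E) ∈ Finset.univ.filter (fun x => x ∈ K) := by simp
  have hcard : (Finset.univ.filter (fun x => x ∈ K)).card = Nat.card K := by
    rw [← Set.ncard_coe_finset]
    simp only [Finset.coe_filter_univ]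
    rfl
  -- Zero lies in every subspace and each other vector in at least one. The proper intersections are
  -- too small for this: with `m = |K| - 1`, the bounds give `|T| (q - 1) + m (q - |T|) ≤ 0`.
  have h2 : ∑ x ∈ Finset.univ.filter (fun x => x ∈ K), ∑ j ∈ T, (if x ∈ U j then 1 else 0) ≥
      T.card + (Nat.card K - 1) := by
    rw [← Finset.add_sum_erase _ _ h0]
    have h3 : ∑ j ∈ T, (if (0 : E) ∈ U j then 1 else 0) = T.card := by simp
    rw [h3]
    refine Nat.add_le_add_left ?_ _
    rw [← hcard, ← Finset.card_erase_of_mem h0, Finset.card_eq_sum_ones]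
    refine Finset.sum_le_sum fun x hx => ?_
    obtain ⟨j, hj, hx⟩ := h x (by simpa using (Finset.mem_erase.1 hx).2)
    refine le_trans (le_of_eq (if_pos hx).symm)
      (Finset.single_le_sum (f := fun j => if x ∈ U j then 1 else 0) (fun _ _ => Nat.zero_le _) hj)
  have h4 : (∑ j ∈ T, Nat.card (K ⊓ U j : Submodule F E)) * Fintype.card F ≤
      T.card * Nat.card K := by
    rw [Finset.sum_mul, ← smul_eq_mul T.card]
    exact Finset.sum_le_card_nsmul _ _ _ hlt
  rw [← h1] at h4
  have h5 := (Nat.mul_le_mul_right (Fintype.card F) h2).trans h4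
  have hTpos : 0 < T.card := by
    obtain ⟨j, hj, -⟩ := h 0 K.zero_mem
    exact Finset.card_pos.2 ⟨j, hj⟩
  have hK : 0 < Nat.card K := Nat.card_pos
  obtain ⟨m, hm⟩ := Nat.exists_eq_add_of_lt hK
  rw [hm] at h5
  simp only [zero_add, Nat.add_sub_cancel] at h5
  nlinarith

/-- Inside `D`, the subspace `V` meets every subspace that it does not contain in a
hyperplane. -/
def Thin (D V : Submodule F E) : Prop :=
  V ≤ D ∧ ∀ K ≤ D, ¬ K ≤ V → Nat.card (K ⊓ V : Submodule F E) * Fintype.card F = Nat.card K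

/-- A nonzero map into a one-dimensional space is onto, so its kernel on `K` has index exactly `q`.
-/
theorem thin_inf_ker [FiniteDimensional F E] {W : Type*} [AddCommGroup W] [Module F W]
    (hW : Module.finrank F W = 1) (D : Submodule F E) (f : E →ₗ[F] W) :
    Thin D (D ⊓ LinearMap.ker f) := by
  have : FiniteDimensional F W := Module.finite_of_finrank_pos (by omega)
  refine ⟨inf_le_left, fun K hK hKV => ?_⟩
  have h1 : K ⊓ (D ⊓ LinearMap.ker f) = (LinearMap.ker (f.domRestrict K)).map K.subtype := by
    ext x
    simp only [Submodule.mem_inf, LinearMap.mem_ker, Submodule.mem_map]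
    constructor
    · rintro ⟨h1, -, h2⟩
      exact ⟨⟨x, h1⟩, h2, rfl⟩
    · rintro ⟨y, hy, rfl⟩
      exact ⟨y.2, hK y.2, hy⟩
  have h2 := (f.domRestrict K).finrank_range_add_finrank_ker
  have h3 : Module.finrank F (LinearMap.range (f.domRestrict K)) = 1 := by
    refine le_antisymm (hW ▸ Submodule.finrank_le _) ?_
    rw [Nat.one_le_iff_ne_zero, ne_eq, Submodule.finrank_eq_zero, LinearMap.range_eq_bot]
    intro h0
    refine hKV fun x hx => ⟨hK hx, ?_⟩
    exact LinearMap.congr_fun h0 ⟨x, hx⟩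
  rw [Module.natCard_eq_pow_finrank (K := F) (V := K),
    Module.natCard_eq_pow_finrank (K := F) (V := (K ⊓ (D ⊓ LinearMap.ker f) : Submodule F E)),
    h1, Submodule.finrank_map_subtype_eq, Nat.card_eq_fintype_card, ← h2, h3, add_comm, pow_succ]

open Classical in
-- Count incidences on `V i`. If no `U j` contained it, each would contribute exactly `|V i| / q`;
-- in the family `V`, the member `V i` contributes `|V i|` and every other at least `|V i| / q`,
-- which is too much.
theorem exists_le_of_thin {ι : Type u} {D : Submodule F E} {S T : Finset ι}
    {V U : ι → Submodule F E} (hV : ∀ i ∈ S, Thin D (V i)) (hU : ∀ j ∈ T, Thin D (U j))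
    (h : ∀ x, ∑ i ∈ S, (if x ∈ V i then 1 else 0) = ∑ j ∈ T, (if x ∈ U j then 1 else 0))
    {i : ι} (hi : i ∈ S) : ∃ j ∈ T, V i ≤ U j := by
  have : Fintype E := Fintype.ofFinite E
  by_contra hno
  push Not at hno
  have hq : 1 < Fintype.card F := Fintype.one_lt_card
  have hST : S.card = T.card := by simpa using h 0
  have h1 := sum_indicator_eq_sum_natCard (V i) S V
  have h2 := sum_indicator_eq_sum_natCard (V i) T U
  have h3 : (∑ j ∈ T, Nat.card (V i ⊓ U j : Submodule F E)) * Fintype.card F =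
      T.card * Nat.card (V i) := by
    rw [Finset.sum_mul, ← smul_eq_mul T.card, ← Finset.sum_const]
    exact Finset.sum_congr rfl fun j hj => (hU j hj).2 _ (hV i hi).1 (hno j hj)
  have h4 : (S.card - 1) * Nat.card (V i) + Nat.card (V i) * Fintype.card F ≤
      (∑ j ∈ S, Nat.card (V i ⊓ V j : Submodule F E)) * Fintype.card F := by
    rw [← Finset.sum_erase_add _ _ hi, add_mul, inf_idem]
    refine Nat.add_le_add_right ?_ _
    rw [Finset.sum_mul, ← Finset.card_erase_of_mem hi, ← smul_eq_mul (Finset.card _)]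
    refine Finset.card_nsmul_le_sum _ _ _ fun j hj => ?_
    by_cases hij : V i ≤ V j
    · rw [inf_eq_left.2 hij]
      exact Nat.le_mul_of_pos_right _ (by omega)
    · exact ((hV j (Finset.mem_of_mem_erase hj)).2 _ (hV i hi).1 hij).ge
  rw [← h1, Finset.sum_congr rfl fun x _ => h x, h2, h3, ← hST] at h4
  have hK : 0 < Nat.card (V i) := Nat.card_pos
  have hS : 0 < S.card := Finset.card_pos.2 ⟨i, hi⟩
  obtain ⟨m, hm⟩ := Nat.exists_eq_add_of_lt hS
  rw [hm] at h4
  simp only [zero_add, Nat.add_sub_cancel] at h4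
  nlinarith

open Classical in
/-- Two families of subspaces whose indicator functions have the same sum agree up to order, if
they have at most `|F|` members or consist of hyperplanes and the whole space. -/
theorem label_card_eq_of_sum_indicator_eq {ι : Type u} {D : Submodule F E} {S T : Finset ι}
    {V U : ι → Submodule F E}
    (hc : S.card ≤ Fintype.card F ∨ (∀ i ∈ S, Thin D (V i)) ∧ ∀ j ∈ T, Thin D (U j))
    (h : ∀ x, ∑ i ∈ S, (if x ∈ V i then 1 else 0) = ∑ j ∈ T, (if x ∈ U j then 1 else 0))
    (K : Submodule F E) :
    (S.filter (fun i => V i = K)).card = (T.filter (fun i => U i = K)).card := by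
  refine label_card_eq_of_cancel V U (fun S T =>
    (S.card ≤ Fintype.card F ∨ (∀ i ∈ S, Thin D (V i)) ∧ ∀ j ∈ T, Thin D (U j)) ∧
    ∀ x, ∑ i ∈ S, (if x ∈ V i then 1 else 0) = ∑ j ∈ T, (if x ∈ U j then 1 else 0)) ?_ S T
    ⟨hc, h⟩ K
  clear hc h S T
  rintro S T ⟨hc, h⟩ hne
  have hST : S.card = T.card := by simpa using h 0
  have hcov : ∀ {S T : Finset ι} {V U : ι → Submodule F E} {i : ι}, i ∈ S →
      (∀ x, ∑ i ∈ S, (if x ∈ V i then 1 else 0) = ∑ j ∈ T, (if x ∈ U j then 1 else 0)) →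
      ∀ x ∈ V i, ∃ j ∈ T, x ∈ U j := by
    intro S T V U i hi h x hx
    by_contra hno
    push Not at hno
    have h1 := h x
    rw [Finset.sum_eq_zero (s := T) fun j hj => if_neg (hno j hj),
      Finset.sum_eq_zero_iff] at h1
    simpa [hx] using h1 i hi
  have hle1 : ∀ i ∈ S, ∃ j ∈ T, V i ≤ U j := by
    intro i hi
    rcases hc with hc | ⟨hV, hU⟩
    · exact exists_le_of_covered (hST ▸ hc) (hcov hi h)
    · exact exists_le_of_thin hV hU h hi
  have hle2 : ∀ j ∈ T, ∃ i ∈ S, U j ≤ V i := by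
    intro j hj
    rcases hc with hc | ⟨hV, hU⟩
    · exact exists_le_of_covered hc (hcov hj fun x => (h x).symm)
    · exact exists_le_of_thin hU hV (fun x => (h x).symm) hj
  have hSne : S.Nonempty := by
    rcases hne with hne | hne
    · exact hne
    · obtain ⟨j, hj⟩ := hne
      obtain ⟨i, hi, -⟩ := hle2 j hj
      exact ⟨i, hi⟩
  -- Maximal dimension collapses the chain `V i ≤ U j ≤ V i'` to equality, giving a pair to cancel.
  obtain ⟨i, hi, hmax⟩ := Finset.exists_max_image S (fun i => Module.finrank F (V i)) hSne
  obtain ⟨j, hj, hij⟩ := hle1 i hi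
  obtain ⟨i', hi', hji⟩ := hle2 j hj
  have heq : V i = U j := by
    refine le_antisymm hij (le_of_le_of_eq hji (Eq.symm ?_))
    exact Submodule.eq_of_le_of_finrank_le (hij.trans hji) (hmax i' hi')
  refine ⟨i, hi, j, hj, heq, ?_, fun x => ?_⟩
  · rcases hc with hc | ⟨hV, hU⟩
    · exact Or.inl ((Finset.card_erase_le).trans hc)
    · exact Or.inr ⟨fun i hi => hV i (Finset.mem_of_mem_erase hi),
        fun j hj => hU j (Finset.mem_of_mem_erase hj)⟩
  · have h1 := h x
    rw [← Finset.add_sum_erase S _ hi, ← Finset.add_sum_erase T _ hj, heq] at h1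
    exact Nat.add_left_cancel h1

end Subspaces

/-! ### Factoring linear maps through equal or nested kernels -/

section LinearAlgebra

variable {F : Type v} [Field F] {X Y Z : Type*} [AddCommGroup X] [Module F X] [AddCommGroup Y]
  [Module F Y] [AddCommGroup Z] [Module F Z]

theorem exists_factor_of_ker_le (a : X →ₗ[F] Z) (b : X →ₗ[F] Y)
    (h : LinearMap.ker a ≤ LinearMap.ker b) : ∃ L : Z →ₗ[F] Y, ∀ x, L (a x) = b x := by
  obtain ⟨s, hs⟩ := a.rangeRestrict.exists_rightInverse_of_surjective a.range_rangeRestrict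
  obtain ⟨L, hL⟩ := LinearMap.exists_extend (b ∘ₗ s)
  refine ⟨L, fun x => ?_⟩
  have h1 := LinearMap.congr_fun hL (a.rangeRestrict x)
  have h2 := congrArg Subtype.val (LinearMap.congr_fun hs (a.rangeRestrict x))
  have h3 : a (s (a.rangeRestrict x)) = a x := h2
  have h4 : s (a.rangeRestrict x) - x ∈ LinearMap.ker a := by simp [h3]
  have h5 := h h4
  rw [LinearMap.mem_ker, map_sub, sub_eq_zero] at h5
  exact h1.trans h5

/-- Both ranges are the same quotient of `X`; in finite dimension an isomorphism between subspaces
extends to the whole space. -/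
theorem exists_linearEquiv_of_ker_eq [FiniteDimensional F Z] (a : X →ₗ[F] Z) (b : X →ₗ[F] Y)
    (e : Z ≃ₗ[F] Y) (h : LinearMap.ker a = LinearMap.ker b) :
    ∃ g : Z ≃ₗ[F] Y, ∀ x, g (a x) = b x := by
  let b' : X →ₗ[F] Z := e.symm.toLinearMap ∘ₗ b
  have hb' : LinearMap.ker a = LinearMap.ker b' := by
    rw [h]
    ext x
    simp [b']
  obtain ⟨g, hg⟩ := Submodule.exists_linearEquiv_restrict_eq
    (a.quotKerEquivRange.symm ≪≫ₗ Submodule.quotEquivOfEq _ _ hb' ≪≫ₗ b'.quotKerEquivRange)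
  refine ⟨g ≪≫ₗ e, fun x => ?_⟩
  have h1 := hg (a.quotKerEquivRange (Submodule.Quotient.mk x))
  rw [LinearEquiv.trans_apply, LinearEquiv.trans_apply, LinearEquiv.symm_apply_apply,
    Submodule.quotEquivOfEq_mk, LinearMap.quotKerEquivRange_apply_mk,
    LinearMap.quotKerEquivRange_apply_mk] at h1
  rw [LinearEquiv.trans_apply, ← h1]
  simp [b']

end LinearAlgebra

/-! ### Coordinate kernels of a weight-preserving map -/

section Extension

variable {Ω : Type u} [Fintype Ω] {F : Type v} [Field F] {H : Ω → Type w}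
  [∀ i, AddCommGroup (H i)] [∀ i, Module F (H i)] {P : PartialOrder Ω} {ω : Ω → ℝ}

/-- The words of a code that vanish above a given level. -/
def levelSub (P : PartialOrder Ω) (C : Submodule F (∀ i, H i)) (r : ℕ) : Submodule F C where
  carrier := {x | ∀ j, r < len P j → (x : ∀ i, H i) j = 0}
  add_mem' hx hy j hj := by simp [hx j hj, hy j hj]
  zero_mem' j _ := rfl
  smul_mem' c x hx j hj := by simp [hx j hj]

theorem ne_zero_iff_mem_idl {β : ∀ i, H i} {r : ℕ} (hβ : ∀ j, r < len P j → β j = 0) {i : Ω}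
    (hi : len P i = r) : β i ≠ 0 ↔ i ∈ idl P β := by
  constructor
  · exact mem_idl_self P
  · intro h
    obtain ⟨b, hb, hib⟩ := mem_idl.1 h
    by_cases e : i = b
    · exact e ▸ hb
    · exact absurd (hβ b (hi ▸ len_lt_len P hib e)) hb

open Classical in
-- The decomposition property provides an automorphism matching the ideals of `x` and `f x`. It
-- depends on `x`, so only the number of vanishing coordinates in each level and weight can be
-- compared.
theorem sum_indicator_ker_eq (hU : UDP P ω) {C : Submodule F (∀ i, H i)}
    {f : C →ₗ[F] (∀ i, H i)} (hf : ∀ x : C, wt P ω (f x) = wt P ω (x : ∀ i, H i)) (r : ℕ) (b : ℝ)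
    (x : C) :
    ∑ i ∈ Finset.univ.filter (fun i => len P i = r ∧ ω i = b),
      (if x ∈ levelSub P C (len P i) ⊓ LinearMap.ker (LinearMap.proj i ∘ₗ C.subtype)
        then 1 else 0) =
    ∑ i ∈ Finset.univ.filter (fun i => len P i = r ∧ ω i = b),
      (if x ∈ levelSub P C (len P i) ⊓ LinearMap.ker (LinearMap.proj i ∘ₗ f) then 1 else 0) := by
  obtain ⟨l, hl, hlω⟩ := hU (idl P (x : ∀ i, H i)) (idl P (f x)) (isIdeal_idl P _)
    (isIdeal_idl P _) (hf x).symm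
  have hl' : ∀ i, l i ∈ idl P (f x) ↔ i ∈ idl P (x : ∀ i, H i) := fun i => by
    rw [← Finset.mem_coe, hl, l.injective.mem_set_image, Finset.mem_coe]
  refine Finset.sum_equiv l.toEquiv (fun i => ?_) fun i hi => ?_
  · simp [len_apply, hlω]
  · simp only [RelIso.coe_fn_toEquiv, Submodule.mem_inf, len_apply]
    by_cases hx : x ∈ levelSub P C (len P i)
    · have hfx : ∀ j, len P i < len P j → f x j = 0 := by
        intro j hj
        by_contra h0
        obtain ⟨j, rfl⟩ := l.surjective j
        obtain ⟨b, hb, hjb⟩ := mem_idl.1 ((hl' j).1 (mem_idl_self P h0))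
        rw [len_apply] at hj
        exact hb (hx b (hj.trans_le (len_le_len P hjb)))
      have h1 : (x : ∀ i, H i) i = 0 ↔ f x (l i) = 0 := by
        rw [← not_iff_not, ← ne_eq, ← ne_eq, ne_zero_iff_mem_idl hx rfl,
          ne_zero_iff_mem_idl hfx (len_apply P l i), hl']
      simp [hx, h1]
    · simp [hx]

end Extension

/-! ### The extension property for hierarchical posets -/

section FiniteField

variable {Ω : Type u} [Fintype Ω] {F : Type v} [Field F] [Fintype F] {k : Ω → ℕ}
  {P : PartialOrder Ω} {ω : Ω → ℝ}

/-- Equal indicator sums and the numeric condition give one permutation, independent of the word,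
that matches all coordinate kernels. Equal kernels yield block isomorphisms that agree with `f` on
words vanishing above the level; triangular corrections take care of the rest. -/
theorem mep_of_conditionD (hω : ∀ i, 0 < ω i) (hP : IsHierarchical P)
    (hD : ConditionD F (fun i => Fin (k i) → F) P ω) (hN : NumericCondition F k P ω) :
    MEP F (fun i => Fin (k i) → F) P ω := by
  classical
  intro C f hf
  let V : Ω → Submodule F C := fun i =>
    levelSub P C (len P i) ⊓ LinearMap.ker (LinearMap.proj i ∘ₗ C.subtype)
  let U : Ω → Submodule F C := fun i =>
    levelSub P C (len P i) ⊓ LinearMap.ker (LinearMap.proj i ∘ₗ f)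
  have hcount : ∀ (r : ℕ) (b : ℝ) (K : Submodule F C),
      ((Finset.univ.filter (fun i => len P i = r ∧ ω i = b)).filter (fun i => V i = K)).card =
      ((Finset.univ.filter (fun i => len P i = r ∧ ω i = b)).filter (fun i => U i = K)).card := by
    intro r b K
    rcases (Finset.univ.filter (fun i => len P i = r ∧ ω i = b)).eq_empty_or_nonempty with h0 | h0
    · rw [h0]
      simp
    obtain ⟨i₀, hi₀⟩ := h0
    simp only [Finset.mem_filter_univ] at hi₀
    refine label_card_eq_of_sum_indicator_eq (D := levelSub P C r) ?_
      (fun x => sum_indicator_ker_eq hD.1 hf r b x) K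
    rcases hN r (hi₀.1 ▸ one_le_len P i₀) (hi₀.1 ▸ len_le_maxChainCard P i₀) b
      ⟨i₀, hi₀.1, hi₀.2⟩ with h1 | h1
    · refine Or.inr ⟨fun i hi => ?_, fun i hi => ?_⟩
      · simp only [Finset.mem_filter_univ] at hi
        simp only [hi.1]
        exact thin_inf_ker (by simp [h1 i hi.1 hi.2]) _ _
      · simp only [Finset.mem_filter_univ] at hi
        simp only [hi.1]
        exact thin_inf_ker (by simp [h1 i hi.1 hi.2]) _ _
    · left
      rw [← Set.ncard_coe_finset]
      convert h1 using 2
      ext i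
      simp [level]
  obtain ⟨σ, hσ⟩ := exists_perm_of_fiber_card_eq (fun i => ((len P i, ω i), V i))
    (fun i => ((len P i, ω i), U i)) (by
      rintro ⟨⟨r, b⟩, K⟩
      simpa only [Prod.mk.injEq, Finset.filter_filter] using hcount r b K)
  simp only [Prod.mk.injEq] at hσ
  let s : P.le ≃r P.le := (hP.relIsoOfLen P σ fun i => (hσ i).1.1).symm
  have hσs : ∀ i, σ (s i) = i := fun i => σ.apply_symm_apply i
  have hsω : ∀ i, ω (s i) = ω i := fun i => by
    have := (hσ (s i)).1.2
    rw [hσs] at this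
    exact this.symm
  have hsU : ∀ i, U i = V (s i) := fun i => by
    have := (hσ (s i)).2
    rwa [hσs] at this
  have key : ∀ i, ∃ g : (Fin (k (s i)) → F) ≃ₗ[F] (Fin (k i) → F),
      ∀ x ∈ levelSub P C (len P i), g ((x : Amb F k) (s i)) = f x i := by
    intro i
    obtain ⟨e⟩ := hD.2 (s i) i (len_apply P s i) (hsω i)
    obtain ⟨g, hg⟩ := exists_linearEquiv_of_ker_eq (X := levelSub P C (len P i))
      ((LinearMap.proj (s i) ∘ₗ C.subtype) ∘ₗ (levelSub P C (len P i)).subtype)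
      ((LinearMap.proj i ∘ₗ f) ∘ₗ (levelSub P C (len P i)).subtype) e (by
        ext x
        have h1 : (x : C) ∈ U i ↔ (x : C) ∈ V (s i) := by rw [hsU]
        simp only [U, V, len_apply, Submodule.mem_inf, x.2, true_and] at h1
        exact h1.symm)
    exact ⟨g, fun x hx => hg ⟨x, hx⟩⟩
  choose g hg using key
  -- The discrepancy between `f` and the block isomorphism vanishes on words that are zero above the
  -- level, so it factors through the coordinates above it and becomes an admissible correction.
  let trunc : ℕ → Amb F k →ₗ[F] Amb F k := fun r =>
    LinearMap.pi fun j => if r < len P j then LinearMap.proj j else 0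
  have htrunc : ∀ r (β : Amb F k), trunc r β = 0 ↔ ∀ j, r < len P j → β j = 0 := by
    intro r β
    rw [funext_iff]
    refine forall_congr' fun j => ?_
    by_cases h : r < len P j <;> simp [trunc, h]
  have hL : ∀ i, ∃ L : Amb F k →ₗ[F] (Fin (k i) → F), ∀ x : C,
      L (trunc (len P i) x) = f x i - g i ((x : Amb F k) (s i)) := by
    intro i
    refine exists_factor_of_ker_le (trunc (len P i) ∘ₗ C.subtype)
      (LinearMap.proj i ∘ₗ f - (g i).toLinearMap ∘ₗ LinearMap.proj (s i) ∘ₗ C.subtype) ?_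
    intro x hx
    have hx : trunc (len P i) (x : Amb F k) = 0 := hx
    rw [LinearMap.mem_ker]
    exact sub_eq_zero.2 (hg i x ((htrunc _ _).1 hx)).symm
  choose L hL using hL
  obtain ⟨φ, hφ, hφ'⟩ := exists_isometry_of_wt (F := F) (H := fun i => Fin (k i) → F) P hω
    (LinearMap.pi fun i => (g i).toLinearMap ∘ₗ LinearMap.proj (s i) +
      L i ∘ₗ trunc (len P i)) (by
      intro α
      refine wt_eq_of_perm P s.toEquiv hsω (mem_idl_of_triangular s fun i hi => ?_)
      have h0 : trunc (len P i) α = 0 := (htrunc _ _).2 fun j hj => by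
        have hj' : len P (s i) < len P j := by rwa [len_apply]
        refine hi j (hP.le_iff.2 (Or.inr hj')) ?_
        rintro rfl
        exact lt_irrefl _ hj'
      simp [h0])
  refine ⟨φ, hφ, fun x => ?_⟩
  rw [hφ']
  funext i
  simp [hL]

theorem dim_eq_of_conditionD (hD : ConditionD F (fun i => Fin (k i) → F) P ω) {u v : Ω}
    (h : len P u = len P v) (h' : ω u = ω v) : k u = k v := by
  obtain ⟨e⟩ := hD.2 u v h h'
  simpa using e.finrank_eq

/-- If `q + 1` blocks of dimension at least two share a level and a weight, embed `F × F` in two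
ways: `a` uses functionals whose kernels are the `q + 1` lines, `d` uses `q` injective maps and one
zero map. A nonzero vector vanishes at exactly one of these blocks either way, so the weights agree,
but no isometry can carry one embedding to the other. -/
theorem numericCondition_of_mep (hω : ∀ i, 0 < ω i) (hk : ∀ i, 0 < k i) (hP : IsHierarchical P)
    (hD : ConditionD F (fun i => Fin (k i) → F) P ω)
    (hM : MEP F (fun i => Fin (k i) → F) P ω) : NumericCondition F k P ω := by
  classical
  intro r _ _ b _
  by_contra hno
  rw [not_or, not_le] at hno
  obtain ⟨h1, h2⟩ := hno
  push Not at h1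
  obtain ⟨i₀, hi₀, hb₀, hk₀⟩ := h1
  have hNe : ∀ i, Nonempty (Fin (k i)) := fun i => ⟨⟨0, hk i⟩⟩
  -- `Option F` plays the projective line: `none` is the vertical line and `some t` the line of
  -- slope `t`.
  obtain ⟨e⟩ := Function.Embedding.nonempty_of_card_le (α := Option F)
    (β := {i | i ∈ level P r ∧ ω i = b}) (by
      rw [Fintype.card_option, ← Nat.card_eq_fintype_card (α := {i | i ∈ level P r ∧ ω i = b}),
        Nat.card_coe_set_eq]
      exact h2)
  have hlen : ∀ o, len P (e o) = r := fun o => (e o).2.1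
  have hωe : ∀ o, ω (e o) = b := fun o => (e o).2.2
  have hinj : ∀ {o o' : Option F}, (e o : Ω) = e o' ↔ o = o' := fun {o o'} =>
    ⟨fun h => e.injective (Subtype.ext h), fun h => h ▸ rfl⟩
  have hke : ∀ o, 2 ≤ k (e o) := fun o => by
    have : k (e o) = k i₀ := dim_eq_of_conditionD hD ((hlen o).trans hi₀.symm)
      ((hωe o).trans hb₀.symm)
    have := hk i₀
    omega
  let G : (∀ o, (F × F) →ₗ[F] (Fin (k (e o)) → F)) → (F × F) →ₗ[F] Amb F k := fun a =>
    ∑ o, LinearMap.single F (fun i => Fin (k i) → F) (e o : Ω) ∘ₗ a o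
  have hG : ∀ a x o, G a x (e o) = a o x := by
    intro a x o
    simp only [G, LinearMap.sum_apply, Finset.sum_apply, LinearMap.comp_apply,
      LinearMap.single_apply]
    rw [Finset.sum_eq_single o]
    · simp
    · intro o' _ ho'
      exact Pi.single_eq_of_ne (fun h => ho' (hinj.1 h).symm) _
    · simp
  have hG' : ∀ a x j, (∀ o, (e o : Ω) ≠ j) → G a x j = 0 := by
    intro a x j hj
    simp only [G, LinearMap.sum_apply, Finset.sum_apply, LinearMap.comp_apply,
      LinearMap.single_apply]
    exact Finset.sum_eq_zero fun o _ => Pi.single_eq_of_ne (hj o).symm _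
  have hGr : ∀ a x j, r < len P j → G a x j = 0 := by
    intro a x j hj
    refine hG' a x j fun o ho => ?_
    rw [← ho, hlen] at hj
    exact lt_irrefl _ hj
  let c : Option F → (F × F) →ₗ[F] F := fun o =>
    o.elim (LinearMap.fst F F F) fun t => LinearMap.snd F F F - t • LinearMap.fst F F F
  let a : ∀ o, (F × F) →ₗ[F] (Fin (k (e o)) → F) := fun o =>
    LinearMap.pi fun _ => c o
  let d : ∀ o, (F × F) →ₗ[F] (Fin (k (e o)) → F) := fun
    | none => 0
    | some _ => LinearMap.pi fun s =>
      if (s : ℕ) = 0 then LinearMap.fst F F F else LinearMap.snd F F F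
  have ha : ∀ o x, a o x = 0 ↔ c o x = 0 := by
    intro o x
    constructor
    · exact fun h => congrFun h ⟨0, hk _⟩
    · intro h
      funext s
      exact h
  have hd : ∀ t x, d (some t) x = 0 ↔ x = 0 := by
    intro t x
    constructor
    · intro h
      have h1 := congrFun h ⟨0, hk _⟩
      have h2 := congrFun h ⟨1, hke _⟩
      simp [d] at h1 h2
      exact Prod.ext h1 h2
    · rintro rfl
      simp
  have hd0 : ∀ x, d none x = 0 := fun x => rfl
  have hmiss : ∀ x : F × F, x ≠ 0 → ∃ o, ∀ o', c o' x = 0 ↔ o' = o := by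
    rintro ⟨x, y⟩ hx
    by_cases h0 : x = 0
    · subst h0
      have hy : y ≠ 0 := by
        rintro rfl
        exact hx rfl
      refine ⟨none, fun o' => ?_⟩
      cases o' <;> simp [c, hy]
    · refine ⟨some (y / x), fun o' => ?_⟩
      cases o' with
      | none => simp [c, h0]
      | some t =>
        simp only [c, Option.elim_some, LinearMap.sub_apply, LinearMap.smul_apply,
          LinearMap.snd_apply, LinearMap.fst_apply, smul_eq_mul, Option.some.injEq]
        rw [sub_eq_zero, eq_div_iff h0, eq_comm]
  have hwt : ∀ x, wt P ω (G d x) = wt P ω (G a x) := by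
    intro x
    by_cases h0 : x = 0
    · simp [h0]
    obtain ⟨o, ho⟩ := hmiss x h0
    -- The only vanishing block is `e o` for `a` and `e none` for `d`; swapping them preserves level
    -- and weight.
    let τ : Equiv.Perm Ω := Equiv.swap (e o : Ω) (e none)
    have hswap : ∀ {X : Type} (g : Ω → X), g (e o) = g (e none) → ∀ i, g (τ i) = g i := by
      intro X g hg i
      by_cases h1 : i = e o
      · rw [h1, Equiv.swap_apply_left, hg]
      · by_cases h2 : i = e none
        · rw [h2, Equiv.swap_apply_right, hg]
        · rw [Equiv.swap_apply_of_ne_of_ne h1 h2]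
    let s := hP.relIsoOfLen P τ (hswap (len P) (by rw [hlen, hlen]))
    refine wt_eq_of_perm P τ (hswap ω (by rw [hωe, hωe]))
      (mem_idl_of_triangular s fun i _ => ?_)
    change G d x i = 0 ↔ G a x (τ i) = 0
    by_cases hi : ∃ o', (e o' : Ω) = i
    · obtain ⟨o', rfl⟩ := hi
      rw [hG]
      have h3 : τ (e o') = e (Equiv.swap o none o') := by
        by_cases h1 : o' = o
        · subst h1
          rw [Equiv.swap_apply_left, Equiv.swap_apply_left]
        · by_cases h2 : o' = none
          · subst h2
            rw [Equiv.swap_apply_right, Equiv.swap_apply_right]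
          · rw [Equiv.swap_apply_of_ne_of_ne h1 h2, Equiv.swap_apply_of_ne_of_ne
              (fun h => h1 (hinj.1 h)) fun h => h2 (hinj.1 h)]
      rw [h3, hG, ha, ho, Equiv.swap_apply_eq_iff, Equiv.swap_apply_left]
      cases o' with
      | none => simp [hd0]
      | some t => simp [hd, h0]
    · push Not at hi
      rw [hG' d x i hi, Equiv.swap_apply_of_ne_of_ne (hi o).symm (hi none).symm, hG' a x i hi]
  have hinjA : Function.Injective (G a) := by
    rw [injective_iff_map_eq_zero]
    intro x hx
    have h3 := hwt x
    rw [hx, wt_zero] at h3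
    have h4 := eq_zero_of_wt_eq_zero P hω h3
    rw [← hd 0 x, ← hG, h4]
    rfl
  let E := LinearEquiv.ofInjective (G a) hinjA
  obtain ⟨φ, hφ, hφ'⟩ := hM (LinearMap.range (G a)) (G d ∘ₗ E.symm.toLinearMap) (by
    intro y
    obtain ⟨x, rfl⟩ := E.surjective y
    rw [LinearMap.comp_apply, LinearEquiv.coe_coe, E.symm_apply_apply]
    exact hwt x)
  have hφa : ∀ x, φ (G a x) = G d x := by
    intro x
    have h3 := hφ' (E x)
    rwa [LinearMap.comp_apply, LinearEquiv.coe_coe, E.symm_apply_apply] at h3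
  obtain ⟨l, -, hl⟩ := hφ.exists_relIso hω
  -- All nonzero vectors have the same support under `d`. Pulled back through the isometry, `(0, 1)`
  -- and `(1, 0)` would generate the same ideal under `a`, yet block `e none` distinguishes them.
  have hidl : idl P (G d (0, 1)) = idl P (G d (1, 0)) := by
    refine idl_congr P fun i => ?_
    by_cases hi : ∃ o', (e o' : Ω) = i
    · obtain ⟨o', rfl⟩ := hi
      rw [hG, hG]
      cases o' with
      | none => simp [hd0]
      | some t => simp [hd]
    · push Not at hi
      rw [hG' d _ i hi, hG' d _ i hi]
  have h3 : (e none : Ω) ∈ idl P (G a (1, 0)) := by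
    rw [← ne_zero_iff_mem_idl (hGr a _) (hlen none), hG, ne_eq, ha]
    simp [c]
  rw [← hl, hφa, ← hidl, ← hφa, hl, ← ne_zero_iff_mem_idl (hGr a _) (hlen none), hG, ne_eq,
    ha] at h3
  exact h3 (by simp [c])

end FiniteField

end WeightedPoset

/-! ### Assembling the implications -/

theorem theorem6p5 {Ω : Type*} [Fintype Ω] [Nonempty Ω] {F : Type*} [Field F] [Fintype F]
    (P : PartialOrder Ω) (ω : Ω → ℝ) (hω : ∀ i, 0 < ω i)
    (k : Ω → ℕ) (hk : ∀ i, 0 < k i) (χ : AddChar F ℂ) (hχ : χ ≠ 1) :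
    (WeightedPoset.MEP F (fun i => Fin (k i) → F) P ω →
      WeightedPoset.IsometriesTransitive F (fun i => Fin (k i) → F) P ω) ∧
    (WeightedPoset.IsometriesTransitive F (fun i => Fin (k i) → F) P ω ↔
      WeightedPoset.ConditionD F (fun i => Fin (k i) → F) P ω) ∧
    (WeightedPoset.ConditionD F (fun i => Fin (k i) → F) P ω →
      WeightedPoset.weightPartition (fun i => Fin (k i) → F) (WeightedPoset.dualPoset P) ω =
        WeightedPoset.dualPartition χ
          (WeightedPoset.weightPartition (fun i => Fin (k i) → F) P ω)) ∧
    (WeightedPoset.weightPartition (fun i => Fin (k i) → F) (WeightedPoset.dualPoset P) ω =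
        WeightedPoset.dualPartition χ
          (WeightedPoset.weightPartition (fun i => Fin (k i) → F) P ω) ↔
      WeightedPoset.AdmitsMacWilliamsIdentity F k P ω) ∧
    (WeightedPoset.AdmitsMacWilliamsIdentity F k P ω →
      WeightedPoset.FourierReflexive χ
        (WeightedPoset.weightPartition (fun i => Fin (k i) → F) P ω)) ∧
    (WeightedPoset.IsHierarchical P →
      (WeightedPoset.MEP F (fun i => Fin (k i) → F) P ω ↔
        WeightedPoset.ConditionD F (fun i => Fin (k i) → F) P ω ∧
          WeightedPoset.NumericCondition F k P ω)) ∧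
    (WeightedPoset.IsHierarchical P → (∀ i, ∃ z : ℤ, ω i = (z : ℝ)) →
      List.TFAE
        [WeightedPoset.IsometriesTransitive F (fun i => Fin (k i) → F) P ω,
         WeightedPoset.ConditionD F (fun i => Fin (k i) → F) P ω,
         WeightedPoset.weightPartition (fun i => Fin (k i) → F) (WeightedPoset.dualPoset P) ω =
           WeightedPoset.dualPartition χ
             (WeightedPoset.weightPartition (fun i => Fin (k i) → F) P ω),
         WeightedPoset.AdmitsMacWilliamsIdentity F k P ω,
         WeightedPoset.FourierReflexive χ
           (WeightedPoset.weightPartition (fun i => Fin (k i) → F) P ω)]) := by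

  have hNe : ∀ i, Nonempty (Fin (k i)) := fun i => ⟨⟨0, hk i⟩⟩
  have h12 := WeightedPoset.transitive_of_MEP (F := F) (H := fun i => Fin (k i) → F) P hω
  have h23 : WeightedPoset.IsometriesTransitive F (fun i => Fin (k i) → F) P ω ↔
      WeightedPoset.ConditionD F (fun i => Fin (k i) → F) P ω :=
    ⟨WeightedPoset.conditionD_of_transitive hω, WeightedPoset.transitive_of_conditionD P hω⟩
  have h34 := fun h => WeightedPoset.eq_dualPartition_of_le χ hk hχ
    (WeightedPoset.le_dualPartition_of_conditionD (P := P) (ω := ω) χ hω hk h)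
  have h45 := WeightedPoset.eq_dualPartition_iff_macWilliams (P := P) χ hω hk hχ
  have h46 := WeightedPoset.fourierReflexive_of_eq_dualPartition (P := P) (ω := ω) χ hk hχ
  refine ⟨h12, h23, h34, h45, fun h => h46 (h45.2 h), fun hP => ?_, fun hP hint => ?_⟩
  · constructor
    · intro h
      have hD := h23.1 (h12 h)
      exact ⟨hD, WeightedPoset.numericCondition_of_mep hω hk hP hD h⟩
    · exact fun h => WeightedPoset.mep_of_conditionD hω hP h.1 h.2
  -- Positive integer weights are natural numbers, as needed for exponents in the generating
  -- functions.
  · have hnat : ∀ i, ∃ n : ℕ, 0 < n ∧ ω i = n := by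
      intro i
      obtain ⟨z, hz⟩ := hint i
      have hz0 : 0 < z := by
        have := hω i
        rw [hz] at this
        exact_mod_cast this
      obtain ⟨n, rfl⟩ := Int.eq_ofNat_of_zero_le hz0.le
      exact ⟨n, by exact_mod_cast hz0, by simpa using hz⟩
    choose n hn hωn using hnat
    have h64 := fun h => WeightedPoset.eq_dualPartition_of_fourierReflexive (P := P) (ω := ω) χ
      hk hχ h (WeightedPoset.dualPartition_le_of_hierarchical χ hχ hP hn hωn hk)
    have h43 := fun h => WeightedPoset.conditionD_of_hierarchical (P := P) (ω := ω) χ hχ hP hn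
      hωn hk (le_of_eq h)
    tfae_have 1 ↔ 2 := h23
    tfae_have 2 → 3 := h34
    tfae_have 3 → 2 := h43
    tfae_have 3 ↔ 4 := h45
    tfae_have 3 → 5 := h46
    tfae_have 5 → 3 := h64
    tfae_finish
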